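/- For integers $m\ge 2$, $n\ge 1$, the Turk's Head link $THK(m,n)$ is the closure of the $m$-strand braid $(\sigma_1\sigma_2^{-1}\sigma_3\cdots\sigma_{m-1}^{\pm1})^n$ (exponents alternating in sign), i.e. the alternating version of the $(m,n)$ torus link; it is a knot exactly when $\gcd(m,n)=1$. The determinant $\det(K)$ of a knot $K$ is the absolute value of any minor obtained by deleting one row and one column of the Fox coloring matrix of a diagram of $K$ (one column per arc, and for each crossing with over-arc $x$ and under-arcs $y,z$ the row $2x-y-z$). **Theorem.** Let $m\ge 3$ and $n\ge 3$ be relatively prime integers such that $m=3$ or $m$ is even. Then $\det THK(m,n)$ is a composite number. More precisely: (a) If $m=3$, then $\det THK(3,n)$ is the number of spanning trees of the wheel on $n+1$ vertices, it equals $L_{2n}-2$, and it equals $5F_n^2$ if $n$ is even and $L_n^2$ if $n$ is odd. Here $F_n$ and $L_n$ are the Fibonacci and Lucas numbers ($F_0=0$, $F_1=1$; $L_0=2$, $L_1=1$). (b) If $m$ is even, then $\det THK(m,n)$ is the number of spanning trees of the Cartesian product of a cycle on $n$ vertices and a path on $m/2$ vertices, and $$\det THK(m,n)=n\prod_{\substack{1\le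 h\le n-1\\ 1\le k\le \frac m2-1}}\left(4\sin^2\frac{h\pi}{n}+4\sin^2\frac{k\pi}{m}\right),$$ where the product is an integer greater than $1$. -/

import Mathlib

open SimpleGraph

namespace TurksHead

/-- A letter of a braid word on `m` strands: the generator `σ_pos` or its inverse. Strand positions
are `0, …, m - 1` and `σ_i` crosses the positions `i` and `i + 1`. If `positive` holds, the strand
that moves from `i` to `i + 1` passes over; otherwise the strand that moves from `i + 1` to `i`
passes over. -/
structure BraidLetter (m : ℕ) where
  pos : Fin (m - 1)
  positive : Bool

namespace BraidLetter

variable {m : ℕ}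

/-- The left one of the two positions that are crossed. -/
def left (b : BraidLetter m) : Fin m := ⟨b.pos, by have := b.pos.isLt; omega⟩

/-- The right one of the two positions that are crossed. -/
def right (b : BraidLetter m) : Fin m := ⟨b.pos + 1, by have := b.pos.isLt; omega⟩

/-- The position at which the over-strand enters the crossing. -/
def overIn (b : BraidLetter m) : Fin m := if b.positive then b.left else b.right

/-- The position at which the over-strand leaves the crossing. -/
def overOut (b : BraidLetter m) : Fin m := if b.positive then b.right else b.left

/-- The position at which the under-strand enters the crossing. -/
def underIn (b : BraidLetter m) : Fin m := b.overOut

/-- The position at which the under-strand leaves the crossing. -/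
def underOut (b : BraidLetter m) : Fin m := b.overIn

end BraidLetter

/-- A braid word of length `L` on `m` strands. Its crossings are indexed by `Fin L`; the crossing
`t` lies between the levels `t` and `t + 1`. -/
abbrev BraidWord (m L : ℕ) : Type := Fin L → BraidLetter m

variable {m L : ℕ}

/-- The elementary steps by which one follows a strand of the closure of a braid diagram without
passing under a crossing. A point `(t, j)` is the strand position `j` at level `t`. -/
inductive ArcStep (w : BraidWord m L) : Fin (L + 1) × Fin m → Fin (L + 1) × Fin m → Prop
  /-- the closing strand from the last level back to the first one -/
  | close (j : Fin m) : ArcStep w (Fin.last L, j) (0, j)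
  /-- a strand that does not take part in the crossing `t` -/
  | pass (t : Fin L) (j : Fin m) (hl : j ≠ (w t).left) (hr : j ≠ (w t).right) :
      ArcStep w (t.castSucc, j) (t.succ, j)
  /-- the over-strand of the crossing `t` -/
  | over (t : Fin L) : ArcStep w (t.castSucc, (w t).overIn) (t.succ, (w t).overOut)

/-- The arcs of the diagram of the closed braid: the pieces into which the link diagram is cut at
its undercrossings. -/
def Arc (w : BraidWord m L) : Type := Quot (ArcStep w)

instance (w : BraidWord m L) : Finite (Arc w) :=
  inferInstanceAs (Finite (Quot (ArcStep w)))

/-- The arc that contains the point at level `t` and position `j`. -/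
def arc (w : BraidWord m L) (t : Fin (L + 1)) (j : Fin m) : Arc w := Quot.mk _ (t, j)

/-- The arc that passes over at the crossing `t`. -/
def overArc (w : BraidWord m L) (t : Fin L) : Arc w := arc w t.castSucc (w t).overIn

/-- The arc that ends at the crossing `t`. -/
def underArcIn (w : BraidWord m L) (t : Fin L) : Arc w := arc w t.castSucc (w t).underIn

/-- The arc that starts at the crossing `t`. -/
def underArcOut (w : BraidWord m L) (t : Fin L) : Arc w := arc w t.succ (w t).underOut

open Classical in
/-- The coloring matrix of the closed braid diagram: the row of a crossing with over-arc `x` and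
under-arcs `y`, `z` is the Fox coloring relation `2 x - y - z`. -/
noncomputable def coloringMatrix (w : BraidWord m L) : Matrix (Fin L) (Arc w) ℤ :=
  fun t a => 2 * (if a = overArc w t then 1 else 0)
    - (if a = underArcIn w t then 1 else 0) - (if a = underArcOut w t then 1 else 0)

open Classical in
/-- The determinant of the link diagram obtained by closing a braid word: with `N` arcs, the
greatest common divisor of all minors of size `N - 1` of the coloring matrix. (For a diagram with
`N` crossings and `N` arcs all these minors have the same absolute value, so that this is the
absolute value of any one of them.) -/
noncomputable def determinant (w : BraidWord m L) : ℕ :=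
  letI := Fintype.ofFinite (Arc w)
  (Finset.univ : Finset ((Fin (Nat.card (Arc w) - 1) → Fin L) ×
    (Fin (Nat.card (Arc w) - 1) → Arc w))).gcd
      fun s => ((coloringMatrix w).submatrix s.1 s.2).det.natAbs

/-- The braid word `(σ₀ σ₁⁻¹ σ₂ σ₃⁻¹ ⋯ σ_{m-2}^{±1})ⁿ` on `m` strands, whose closure is the
standard diagram of the Turk's Head link `THK(m, n)`. (With all exponents `+1` it would be the
`(m, n)` torus link; the alternating signs make the diagram alternating.) -/
def thk (m n : ℕ) : BraidWord m (n * (m - 1)) :=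
  fun t => ⟨t.modNat, decide (Even (t.modNat : ℕ))⟩

/-- The number of spanning trees of a graph. -/
noncomputable def numSpanningTrees {V : Type*} (G : SimpleGraph V) : ℕ :=
  Nat.card {T : SimpleGraph V // T ≤ G ∧ T.IsTree}

/-- The wheel on `n + 1` vertices: a cycle of length `n` (the vertices `some i`) and a hub `none`
that is adjacent to all its vertices. -/
def wheelGraph (n : ℕ) : SimpleGraph (Option (Fin n)) where
  Adj x y := match x, y with
    | none, none => False
    | none, some _ => True
    | some _, none => True
    | some i, some j => (cycleGraph n).Adj i j
  symm := ⟨by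
    rintro (_ | i) (_ | j) h
    · exact h
    · trivial
    · trivial
    · exact SimpleGraph.Adj.symm (G := cycleGraph n) h⟩
  loopless := ⟨by
    rintro (_ | i) h
    · exact h
    · exact (cycleGraph n).loopless.irrefl i h⟩

/-- The Lucas numbers `2, 1, 3, 4, 7, 11, …`. -/
def lucas : ℕ → ℕ
  | 0 => 2
  | 1 => 1
  | n + 2 => lucas (n + 1) + lucas n

end TurksHead

/-! Because the diagram alternates, every arc passes over exactly one crossing. Arcs and crossings
are therefore both labelled by a position in the braid period and an index of the period in `ZMod
n`, and the coloring matrix becomes a square block circulant matrix. Its rows and columns sum to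
zero. For such a matrix of size N, adding the all-ones matrix J gives determinant N² times any
maximal proper minor, up to sign (`det_add_const`, `gcd_minors_mul_sq`). For a Laplace matrix that
minor is the number of spanning trees (`adjugate_lapMatrix`), so the link and the grid graph can be
compared through det(· + J), without choosing minors.

The discrete Fourier transform (`det_blockCirculant`) splits these determinants into one small
determinant per n-th root of unity z. For both the link and the grid the blocks add up to a path
Laplacian, so the factor at z = 1 is known; after cancellation, n times the invariant is, up to
sign, the product over z ≠ 1. There the blocks are tridiagonal. For even m both determinants are (2
- z - z⁻¹) times a Chebyshev value at 4 - z - z⁻¹ (`det_twistedColoring_even`, `det_pathLaplacian`),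
which proves the equality with the grid. For m = 3 the determinant is (1 - z)(3 - z - z⁻¹); the
factors 1 - z multiply to n, and the others give the wheel.

For even m the roots of the Chebyshev polynomial turn the product into n times a product q of sums
of sines. This q is a rational algebraic integer with q ≥ n², so the determinant n q is composite.
For m = 3 the factor 3 - z - z⁻¹ splits over the squares of the golden ratio and its conjugate; the
product is L_{2n} - 2, which is a square or five times a square. -/

namespace TurksHead

/-! ### Minors of matrices with zero row and column sums -/

section ZeroSum

variable {κ R : Type*} [Fintype κ] [DecidableEq κ] [CommRing R]

/-- The difference of the two cofactors is the determinant of `A` with row `i` replaced by a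
difference of unit vectors. All rows of that matrix sum to zero, so it kills the all-ones vector. -/
theorem adjugate_apply_eq_of_sum_row_eq_zero [IsDomain R] {A : Matrix κ κ R}
    (hr : ∀ i, ∑ j, A i j = 0) (i j k : κ) : A.adjugate j i = A.adjugate k i := by
  rw [← sub_eq_zero, Matrix.adjugate_apply, Matrix.adjugate_apply]
  have h : (A.updateRow i (Pi.single j 1 - Pi.single k 1)).det = 0 := by
    apply Matrix.exists_mulVec_eq_zero_iff.mp
    refine ⟨fun _ => 1, fun h => one_ne_zero (congrFun h i), ?_⟩
    ext l
    rw [Matrix.mulVec, dotProduct]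
    by_cases hl : l = i
    · subst hl; simp
    · simp [Matrix.updateRow_ne hl, hr]
  have h2 := Matrix.det_updateRow_add A i (Pi.single j 1 - Pi.single k 1) (Pi.single k 1)
  rw [sub_add_cancel, h, zero_add] at h2
  rw [h2, sub_self]

/-- Adding a constant to all entries of a matrix with zero row and column sums. -/
theorem det_add_const [IsDomain R] {A : Matrix κ κ R}
    (hr : ∀ i, ∑ j, A i j = 0) (hc : ∀ j, ∑ i, A i j = 0) (t : R) (r : κ) :
    (A + Matrix.of fun _ _ => t).det = t * (Fintype.card κ : R) ^ 2 * A.adjugate r r := by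
  set C : Matrix κ κ R := A.updateRow r (A r + fun _ => 1) with hC
  have hdetA : A.det = 0 := by
    apply Matrix.exists_mulVec_eq_zero_iff.mp
    refine ⟨fun _ => 1, fun h => one_ne_zero (congrFun h r), ?_⟩
    ext l
    simp [Matrix.mulVec, dotProduct, hr]
  have hdetC : C.det = (Fintype.card κ : R) * A.adjugate r r := by
    rw [hC, Matrix.det_updateRow_add, Matrix.updateRow_eq_self, hdetA, zero_add]
    have h1 : (fun _ : κ => (1 : R)) = ∑ j, Pi.single j 1 := by
      ext l; simp [Finset.sum_apply, Pi.single_apply]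
    have h2 : (A.updateRow r fun _ => 1).det = ∑ j, A.adjugate j r := by
      rw [h1, ← Matrix.cramer_transpose_apply, map_sum, Finset.sum_apply]
      rfl
    rw [h2, Finset.sum_congr rfl fun j _ => adjugate_apply_eq_of_sum_row_eq_zero hr r j r]
    simp
  have hsumC : ∀ j, ∑ i, C i j = 1 := by
    intro j
    have : ∀ i, C i j = A i j + if i = r then 1 else 0 := by
      intro i
      by_cases hi : i = r
      · subst hi; simp [hC]
      · simp [hC, hi]
    simp [this, Finset.sum_add_distrib, hc]
  -- The column sums of `C` are 1, so multiplying a column vector u times the all-ones row by `C`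
  -- changes nothing. With u = t·1 - e_r the product adds `t` everywhere and removes the ones that
  -- were added to row `r`.
  have hfac : A + Matrix.of (fun _ _ => t) =
      (1 + Matrix.replicateCol Unit (fun i => t - if i = r then 1 else 0) *
        Matrix.replicateRow Unit (fun _ : κ => (1 : R))) * C := by
    rw [add_mul, one_mul, Matrix.mul_assoc]
    ext i j
    rw [Matrix.add_apply, Matrix.add_apply, Matrix.mul_apply]
    simp only [Finset.univ_unique, Finset.sum_singleton, Matrix.replicateCol_apply,
      Matrix.mul_apply, Matrix.replicateRow_apply, one_mul, hsumC, mul_one, Matrix.of_apply]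
    by_cases hi : i = r
    · subst hi; simp [hC]
    · simp [hC, hi]
  rw [hfac, Matrix.det_mul, Matrix.det_one_add_replicateCol_mul_replicateRow, hdetC]
  have : (fun _ : κ => (1 : R)) ⬝ᵥ (fun i => t - if i = r then 1 else 0) =
      (Fintype.card κ : R) * t - 1 := by
    simp [dotProduct]
  rw [this]; ring

end ZeroSum

theorem exists_equiv_extending {γ : Type*} [Fintype γ] {k : ℕ}
    (hcard : Fintype.card γ = k + 1) (f : Fin k → γ) (hf : f.Injective) :
    ∃ f' : Fin (k + 1) ≃ γ, ∀ i, f' i.succ = f i := by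
  have : ¬ f.Surjective := by
    intro hs
    have := Fintype.card_le_of_surjective f hs
    rw [hcard, Fintype.card_fin] at this
    omega
  obtain ⟨x, hx⟩ := not_forall.mp this
  have hinj : (Fin.cons x f : Fin (k + 1) → γ).Injective :=
    Fin.cons_injective_iff.mpr ⟨hx, hf⟩
  have hb : (Fin.cons x f : Fin (k + 1) → γ).Bijective :=
    (Fintype.bijective_iff_injective_and_card _).mpr ⟨hinj, by simp [hcard]⟩
  exact ⟨Equiv.ofBijective _ hb, fun i => by simp⟩

/-- All maximal proper minors of an integer matrix with zero row and column sums agree up to sign,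
so that each of them is their greatest common divisor. -/
theorem gcd_minors_mul_sq {α β κ : Type*} [Fintype α] [Fintype β] [Fintype κ]
    [DecidableEq κ] (M : Matrix α β ℤ)
    (hr : ∀ i, ∑ j, M i j = 0) (hc : ∀ j, ∑ i, M i j = 0) (e : κ ≃ α) (e' : κ ≃ β) (k : ℕ)
    (hk : Fintype.card κ = k + 1) :
    (Finset.univ : Finset ((Fin k → α) × (Fin k → β))).gcd
      (fun s => (M.submatrix s.1 s.2).det.natAbs) * (k + 1) ^ 2 =
      (M.submatrix e e' + Matrix.of fun _ _ => 1).det.natAbs := by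
  have minor : ∀ (f : Fin k → α) (g : Fin k → β), f.Injective → g.Injective →
      (M.submatrix f g).det.natAbs * (k + 1) ^ 2 =
        (M.submatrix e e' + Matrix.of fun _ _ => 1).det.natAbs := by
    intro f g hf hg
    obtain ⟨f', hf'⟩ := exists_equiv_extending ((Fintype.card_congr e).symm.trans hk) f hf
    obtain ⟨g', hg'⟩ := exists_equiv_extending ((Fintype.card_congr e').symm.trans hk) g hg
    have h1 : (M.submatrix f' g').submatrix Fin.succ Fin.succ = M.submatrix f g := by
      ext i j; simp [hf', hg']
    have h2 := det_add_const (A := M.submatrix f' g')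
      (fun i => by simpa using (Equiv.sum_comp g' (M (f' i))).trans (hr _))
      (fun j => by simpa using (Equiv.sum_comp f' fun i => M i (g' j)).trans (hc _)) 1 0
    have h3 : (M.submatrix f' g').adjugate 0 0 = (M.submatrix f g).det := by
      rw [Matrix.adjugate_fin_succ_eq_det_submatrix, ← h1]
      simp
    have h4 : M.submatrix f' g' + Matrix.of (fun _ _ => 1) =
        (M.submatrix e e' + Matrix.of fun _ _ => 1).submatrix (f'.trans e.symm)
          (g'.trans e'.symm) := by
      ext i j; simp
    rw [h3, h4] at h2
    have h5 := congrArg Int.natAbs h2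
    have h6 := Matrix.abs_det_submatrix_equiv_equiv (f'.trans e.symm) (g'.trans e'.symm)
      (M.submatrix e e' + Matrix.of fun _ _ => 1)
    rw [Int.abs_eq_natAbs, Int.abs_eq_natAbs] at h6
    rw [← Nat.cast_inj (R := ℤ).mp h6, h5, Int.natAbs_mul, Int.natAbs_mul]
    have h7 : ((Fintype.card (Fin (k + 1)) : ℤ) ^ 2).natAbs = (k + 1) ^ 2 := by
      rw [Int.natAbs_pow]; simp; norm_cast
    rw [h7]; simp [mul_comm]
  let e0 : Fin (k + 1) ≃ κ := (Fintype.equivFinOfCardEq hk).symm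
  let f : Fin k → α := fun i => e (e0 i.succ)
  let g : Fin k → β := fun i => e' (e0 i.succ)
  have hf : f.Injective := e.injective.comp (e0.injective.comp (Fin.succ_injective k))
  have hg : g.Injective := e'.injective.comp (e0.injective.comp (Fin.succ_injective k))
  rw [← minor f g hf hg]
  congr 1
  apply Nat.dvd_antisymm
  · exact Finset.gcd_dvd (Finset.mem_univ (f, g))
  -- Injective selections give the same absolute minor as the fixed one; a repeated row or column
  -- gives minor zero, which everything divides.
  · refine Finset.dvd_gcd fun s _ => ?_
    by_cases h1 : s.1.Injective
    · by_cases h2 : s.2.Injective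
      · have := (minor s.1 s.2 h1 h2).trans (minor f g hf hg).symm
        rw [Nat.eq_of_mul_eq_mul_right (by positivity) this]
      · simp only [Function.Injective, not_forall] at h2
        obtain ⟨a, b, hab, hne⟩ := h2
        have : (M.submatrix s.1 s.2).det = 0 :=
          Matrix.det_zero_of_column_eq hne fun i => by simp [hab]
        simp [this]
    · simp only [Function.Injective, not_forall] at h1
      obtain ⟨a, b, hab, hne⟩ := h1
      have : (M.submatrix s.1 s.2).det = 0 :=
        Matrix.det_zero_of_row_eq hne (by ext i; simp [hab])
      simp [this]

/-! ### Block circulant matrices -/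

/-- The determinant of a block circulant matrix, by the discrete Fourier transform. -/
theorem det_blockCirculant {n : ℕ} [NeZero n] {ι : Type*} [Fintype ι] [DecidableEq ι]
    (A : ZMod n → Matrix ι ι ℂ) :
    (Matrix.of fun p q : ι × ZMod n => A (q.2 - p.2) p.1 q.1).det =
      ∏ h : ZMod n, (∑ d, ZMod.stdAddChar (d * h) • A d).det := by
  set F : Matrix (ι × ZMod n) (ι × ZMod n) ℂ :=
    Matrix.of fun p q => if p.1 = q.1 then ZMod.stdAddChar (p.2 * q.2) else 0 with hF
  set F' : Matrix (ι × ZMod n) (ι × ZMod n) ℂ :=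
    Matrix.of fun p q => if p.1 = q.1 then ZMod.stdAddChar (-(p.2 * q.2)) else 0 with hF'
  have hFF : F * F' = (n : ℂ) • (1 : Matrix (ι × ZMod n) (ι × ZMod n) ℂ) := by
    ext ⟨i, r⟩ ⟨j, s⟩
    rw [Matrix.mul_apply, Fintype.sum_prod_type]
    have h := AddChar.sum_mulShift (R' := ℂ) (r - s) (ZMod.isPrimitive_stdAddChar n)
    by_cases hij : i = j
    · subst hij
      simp only [hF, hF', Matrix.of_apply, ite_mul, zero_mul, mul_ite, mul_zero,
        Finset.sum_ite_irrel, Finset.sum_const_zero,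
        ← AddChar.map_add_eq_mul, Matrix.smul_apply, Matrix.one_apply, Prod.mk.injEq, true_and]
      rw [ZMod.card] at h
      simp only [sub_eq_zero] at h
      have h' : ∀ x : ZMod n, r * x + -(x * s) = x * (r - s) := fun x => by ring
      simp only [h', h]
      split_ifs <;> simp
    · simp [hF, hF', hij]
  have hFdet : F.det ≠ 0 := by
    intro h0
    have := congrArg Matrix.det hFF
    rw [Matrix.det_mul, h0, zero_mul, Matrix.det_smul, Matrix.det_one, mul_one] at this
    exact pow_ne_zero _ (Nat.cast_ne_zero.mpr (NeZero.ne n)) this.symm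
  -- The Fourier matrix `F` intertwines the block circulant matrix with a block diagonal one. As `F`
  -- is invertible, the two determinants agree.
  have hT : (Matrix.of fun p q : ι × ZMod n => A (q.2 - p.2) p.1 q.1) * F =
      F * Matrix.blockDiagonal fun h => ∑ d, ZMod.stdAddChar (d * h) • A d := by
    ext ⟨i, r⟩ ⟨j, h⟩
    rw [Matrix.mul_apply, Matrix.mul_apply, Fintype.sum_prod_type, Fintype.sum_prod_type]
    simp only [hF, Matrix.of_apply, mul_ite, mul_zero, Finset.sum_ite_irrel,
      Finset.sum_const_zero, Finset.sum_ite_eq', Finset.mem_univ, if_true, ite_mul, zero_mul,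
      Finset.sum_ite_eq, Matrix.blockDiagonal_apply, Matrix.sum_apply, Matrix.smul_apply,
      smul_eq_mul, Finset.mul_sum]
    rw [← Equiv.sum_comp (Equiv.addRight r)]
    refine Finset.sum_congr rfl fun d _ => ?_
    simp only [Equiv.coe_addRight, add_sub_cancel_right, ← mul_assoc, ← AddChar.map_add_eq_mul]
    rw [mul_comm]
    congr 2
    ring
  have := congrArg Matrix.det hT
  rw [Matrix.det_mul, Matrix.det_mul, mul_comm, Matrix.det_blockDiagonal] at this
  exact mul_left_cancel₀ hFdet this

/-! ### Tridiagonal determinants -/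

/-- The tridiagonal matrix with diagonal `a`, upper diagonal `b` and lower diagonal `c`. -/
def tridiagonal {R : Type*} [Zero R] (a b c : ℕ → R) (n : ℕ) : Matrix (Fin n) (Fin n) R :=
  Matrix.of fun i j =>
    if (i : ℕ) = j then a i else if (i : ℕ) + 1 = j then b i else if (j : ℕ) + 1 = i then c j else 0

/-- Expand along the last row, which has two entries that may be nonzero. In the minor belonging to
`c n`, only `b n` survives in the last column. -/
theorem det_tridiagonal_add_two {R : Type*} [CommRing R] (a b c : ℕ → R) (n : ℕ) :
    (tridiagonal a b c (n + 2)).det =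
      a (n + 1) * (tridiagonal a b c (n + 1)).det - b n * c n * (tridiagonal a b c n).det := by
  rw [Matrix.det_succ_row _ (Fin.last _), Fin.sum_univ_castSucc, Fin.sum_univ_castSucc]
  have h0 : ∀ i : Fin n, tridiagonal a b c (n + 2) (Fin.last (n + 1)) i.castSucc.castSucc = 0 := by
    intro i
    have := i.isLt
    simp only [tridiagonal, Matrix.of_apply, Fin.val_last, Fin.val_castSucc]
    rw [if_neg (by omega), if_neg (by omega), if_neg (by omega)]
  have h1 : tridiagonal a b c (n + 2) (Fin.last (n + 1)) (Fin.last n).castSucc = c n := by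
    simp only [tridiagonal, Matrix.of_apply, Fin.val_last, Fin.val_castSucc]
    simp; omega
  have h2 : tridiagonal a b c (n + 2) (Fin.last (n + 1)) (Fin.last (n + 1)) = a (n + 1) := by
    simp [tridiagonal]
  have h3 : (tridiagonal a b c (n + 2)).submatrix (Fin.last (n + 1)).succAbove
      (Fin.last (n + 1)).succAbove = tridiagonal a b c (n + 1) := by
    ext i j
    simp [tridiagonal]
  have h4 : ((tridiagonal a b c (n + 2)).submatrix (Fin.last (n + 1)).succAbove
      (Fin.last n).castSucc.succAbove).det = b n * (tridiagonal a b c n).det := by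
    rw [Matrix.det_succ_column _ (Fin.last n), Fin.sum_univ_castSucc]
    have h5 : ∀ i : Fin n, (tridiagonal a b c (n + 2)).submatrix (Fin.last (n + 1)).succAbove
        (Fin.last n).castSucc.succAbove i.castSucc (Fin.last n) = 0 := by
      intro i
      have := i.isLt
      simp only [tridiagonal, Matrix.of_apply, Fin.val_last, Fin.val_castSucc,
        Matrix.submatrix_apply, Fin.succAbove_last, Fin.succAbove_castSucc_self, Fin.val_succ]
      rw [if_neg (by omega), if_neg (by omega), if_neg (by omega)]
    have h6 : (tridiagonal a b c (n + 2)).submatrix (Fin.last (n + 1)).succAbove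
        (Fin.last n).castSucc.succAbove (Fin.last n) (Fin.last n) = b n := by
      simp [tridiagonal]
    have h7 : ((tridiagonal a b c (n + 2)).submatrix (Fin.last (n + 1)).succAbove
        (Fin.last n).castSucc.succAbove).submatrix (Fin.last n).succAbove (Fin.last n).succAbove =
        tridiagonal a b c n := by
      ext i j
      have : (Fin.last n).castSucc.succAbove j.castSucc = j.castSucc.castSucc := by
        rw [Fin.succAbove_of_castSucc_lt]
        simp [Fin.lt_def]
      simp [tridiagonal, this]
    simp only [h5, h6, h7, mul_zero, zero_mul, Finset.sum_const_zero, zero_add]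
    simp [← two_mul, pow_mul]
  simp only [h0, h1, h2, h3, h4, mul_zero, zero_mul, Finset.sum_const_zero, zero_add]
  simp only [Fin.val_last, Fin.val_castSucc]
  rw [show n + 1 + n = 2 * n + 1 by ring, show n + 1 + (n + 1) = 2 * (n + 1) by ring, pow_succ,
    pow_mul, pow_mul]
  simp; ring

theorem det_tridiagonal_zero {R : Type*} [CommRing R] (a b c : ℕ → R) :
    (tridiagonal a b c 0).det = 1 := by simp

theorem det_tridiagonal_one {R : Type*} [CommRing R] (a b c : ℕ → R) :
    (tridiagonal a b c 1).det = a 0 := by simp [tridiagonal]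

theorem tridiagonal_congr {R : Type*} [CommRing R] {a a' b b' c c' : ℕ → R} {n : ℕ}
    (ha : ∀ i < n, a i = a' i) (hb : ∀ i, i + 1 < n → b i = b' i)
    (hc : ∀ i, i + 1 < n → c i = c' i) :
    tridiagonal a b c n = tridiagonal a' b' c' n := by
  ext i j
  have := i.isLt
  have := j.isLt
  simp only [tridiagonal, Matrix.of_apply]
  split_ifs with h1 h2 h3
  · exact ha _ (by omega)
  · exact hb _ (by omega)
  · exact hc _ (by omega)
  · rfl

/-! ### The matrix-tree theorem -/

section MatrixTree

variable {V : Type*}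

/-- `f` sends each vertex other than the root `r` to its parent in a spanning tree of `G`. -/
structure IsParentMap (G : SimpleGraph V) (r : V) (f : V → V) : Prop where
  root : f r = r
  adj : ∀ v, v ≠ r → G.Adj v (f v)
  reach : ∀ v, ∃ k, f^[k] v = r

/-- The graph whose edges join the vertices other than `r` to their images under `f`. -/
def parentGraph (r : V) (f : V → V) : SimpleGraph V :=
  SimpleGraph.fromRel fun a b => a ≠ r ∧ b = f a

theorem parentGraph_adj {r : V} {f : V → V} {a b : V} :
    (parentGraph r f).Adj a b ↔ a ≠ b ∧ (a ≠ r ∧ b = f a ∨ b ≠ r ∧ a = f b) := Iff.rfl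

variable {G : SimpleGraph V} {r : V}

namespace IsParentMap

variable {f g : V → V}

theorem parentGraph_le (hf : IsParentMap G r f) : parentGraph r f ≤ G := by
  intro a b h
  obtain ⟨-, ⟨h1, h2⟩ | ⟨h1, h2⟩⟩ := parentGraph_adj.mp h
  · subst h2; exact hf.adj a h1
  · subst h2; exact (hf.adj b h1).symm

theorem parentGraph_adj_apply (hf : IsParentMap G r f) {v : V} (hv : v ≠ r) :
    (parentGraph r f).Adj v (f v) :=
  parentGraph_adj.mpr ⟨(hf.adj v hv).ne, Or.inl ⟨hv, rfl⟩⟩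

theorem connected (hf : IsParentMap G r f) : (parentGraph r f).Connected := by
  have key : ∀ k v, f^[k] v = r → (parentGraph r f).Reachable v r := by
    intro k
    induction k with
    | zero => intro v hv; rw [show v = r from hv]
    | succ k ih =>
      intro v hv
      by_cases h : v = r
      · rw [h]
      · exact (hf.parentGraph_adj_apply h).reachable.trans (ih (f v) hv)
  have key' : ∀ v, (parentGraph r f).Reachable v r := fun v => key _ v (hf.reach v).choose_spec
  have : Nonempty V := ⟨r⟩
  exact ⟨fun u v => (key' u).trans (key' v).symm⟩

/-- The graph is connected and every edge joins some `v ≠ r` to `f v`, which leaves at most one edge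
fewer than there are vertices. -/
theorem isTree [Finite V] (hf : IsParentMap G r f) : (parentGraph r f).IsTree := by
  refine isTree_iff_connected_and_card.mpr ⟨hf.connected, le_antisymm ?_ ?_⟩
  · have hsub : (parentGraph r f).edgeSet ⊆ (fun v => s(v, f v)) '' {v | v ≠ r} := by
      intro e
      induction e with
      | h a b =>
        intro h
        obtain ⟨-, ⟨h1, h2⟩ | ⟨h1, h2⟩⟩ := parentGraph_adj.mp h
        · exact ⟨a, h1, congrArg (fun x => s(a, x)) h2.symm⟩
        · exact ⟨b, h1, (congrArg (fun x => s(b, x)) h2.symm).trans Sym2.eq_swap⟩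
    have h1 := (Set.ncard_le_ncard hsub (Set.toFinite _)).trans (Set.ncard_image_le (Set.toFinite _))
    have h2 : {v | v ≠ r}.ncard + 1 = Nat.card V := by
      have := Set.ncard_add_ncard_compl {r}
      rw [Set.ncard_singleton] at this
      rw [← this, add_comm]; rfl
    rw [← h2]
    exact Nat.add_le_add_right h1 1
  · exact hf.connected.card_vert_le_card_edgeSet_add_one

theorem parentGraph_injective (hf : IsParentMap G r f) (hg : IsParentMap G r g)
    (h : parentGraph r f = parentGraph r g) : f = g := by
  have key : ∀ k v, f^[k] v = r → f v = g v := by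
    intro k
    induction k with
    | zero => intro v hv; rw [show v = r from hv, hf.root, hg.root]
    | succ k ih =>
      intro v hv
      by_cases hvr : v = r
      · rw [hvr, hf.root, hg.root]
      have h1 := hf.parentGraph_adj_apply hvr
      rw [h] at h1
      obtain ⟨-, ⟨-, h2⟩ | ⟨h2, h3⟩⟩ := parentGraph_adj.mp h1
      · exact h2
      -- Otherwise `v = g (f v) = f (f v)` by induction, so the orbit of `v` alternates between `v`
      -- and `f v` and never meets the root.
      · exfalso
        rw [← ih (f v) hv] at h3
        have h4 : ∀ j, f^[j] v = v ∨ f^[j] v = f v := by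
          intro j
          induction j with
          | zero => exact Or.inl rfl
          | succ j ihj =>
            rw [Function.iterate_succ_apply']
            rcases ihj with e | e <;> rw [e]
            · exact Or.inr rfl
            · exact Or.inl h3.symm
        rcases h4 (k + 1) with e | e <;> rw [hv] at e
        · exact hvr e.symm
        · exact h2 e.symm
  exact funext fun v => key _ v (hf.reach v).choose_spec

end IsParentMap

/-- Take as parent a neighbour closer to the root. The resulting graph is a connected subgraph of
`T`, and a tree is minimal among connected graphs. -/
theorem exists_isParentMap [Finite V] {T : SimpleGraph V} (hTG : T ≤ G) (hT : T.IsTree) (r : V) :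
    ∃ f, IsParentMap G r f ∧ parentGraph r f = T := by
  have hex : ∀ v, v ≠ r → ∃ u, T.Adj v u ∧ T.dist u r < T.dist v r := by
    intro v hv
    obtain ⟨p, hp⟩ := hT.connected.exists_walk_length_eq_dist v r
    cases p with
    | nil => exact absurd rfl hv
    | cons h q =>
      refine ⟨_, h, ?_⟩
      rw [← hp, Walk.length_cons]
      exact Nat.lt_succ_of_le (dist_le q)
  choose! g hg using hex
  classical
  let f : V → V := fun v => if v = r then r else g v
  have hfv : ∀ v, v ≠ r → f v = g v := fun v hv => if_neg hv
  have hf : IsParentMap T r f := by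
    refine ⟨if_pos rfl, fun v hv => ?_, ?_⟩
    · rw [hfv v hv]; exact (hg v hv).1
    · intro v
      induction hd : T.dist v r using Nat.strong_induction_on generalizing v with
      | h d ih =>
        by_cases hv : v = r
        · exact ⟨0, hv⟩
        · obtain ⟨k, hk⟩ := ih _ (hd ▸ (hg v hv).2) (g v) rfl
          exact ⟨k + 1, by rw [Function.iterate_succ_apply, hfv v hv, hk]⟩
  refine ⟨f, ⟨hf.root, fun v hv => hTG (hf.adj v hv), hf.reach⟩, ?_⟩
  exact le_antisymm hf.parentGraph_le
    ((isTree_iff_minimal_connected.mp hT).2 hf.connected hf.parentGraph_le)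

theorem numSpanningTrees_eq_card_isParentMap [Finite V] (G : SimpleGraph V) (r : V) :
    numSpanningTrees G = Nat.card {f : V → V // IsParentMap G r f} := by
  symm
  refine Nat.card_eq_of_bijective
    (fun f => ⟨parentGraph r f.1, f.2.parentGraph_le, f.2.isTree⟩) ⟨?_, ?_⟩
  · intro f g h
    exact Subtype.ext (f.2.parentGraph_injective g.2 (congrArg Subtype.val h))
  · intro T
    obtain ⟨f, hf, h⟩ := exists_isParentMap T.2.1 T.2.2 r
    exact ⟨⟨f, hf⟩, Subtype.ext h⟩

variable [Fintype V] [DecidableEq V]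

/-- The matrix whose row at the root is the unit vector of the root and whose row at any other
vertex `v` is the difference of the unit vectors of `v` and `f v`. -/
def parentMatrix (r : V) (f : V → V) : Matrix V V ℤ :=
  fun v => if v = r then Pi.single r 1 else Pi.single v 1 - Pi.single (f v) 1

theorem det_parentMatrix_of_not_reach {f : V → V} (hroot : f r = r)
    (hf : ¬ ∀ v, ∃ k, f^[k] v = r) : (parentMatrix r f).det = 0 := by
  classical
  push Not at hf
  obtain ⟨w, hw⟩ := hf
  apply Matrix.exists_mulVec_eq_zero_iff.mp
  -- The indicator of the vertices that never reach the root is invariant under `f`, hence lies in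
  -- the kernel.
  refine ⟨fun v => if ∃ k, f^[k] v = r then 0 else 1, fun h => ?_, ?_⟩
  · have := congrFun h w
    rw [if_neg (by push Not; exact hw)] at this
    exact one_ne_zero this
  · ext v
    by_cases hv : v = r
    · subst hv
      simp only [Matrix.mulVec, parentMatrix, if_pos, single_dotProduct, one_mul, Pi.zero_apply]
      exact if_pos ⟨0, rfl⟩
    · simp only [Matrix.mulVec, parentMatrix, if_neg hv, sub_dotProduct, single_dotProduct,
        one_mul, Pi.zero_apply, sub_eq_zero]
      congr 1
      apply propext
      constructor
      · rintro ⟨k, hk⟩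
        refine ⟨k, ?_⟩
        rw [← Function.iterate_succ_apply, Function.iterate_succ_apply', hk, hroot]
      · rintro ⟨k, hk⟩
        exact ⟨k + 1, hk⟩

theorem det_parentMatrix_of_reach {f : V → V} (hf : ∀ v, ∃ k, f^[k] v = r) :
    (parentMatrix r f).det = 1 := by
  have hdec : ∀ v, v ≠ r → Nat.find (hf (f v)) < Nat.find (hf v) := by
    intro v hv
    obtain ⟨k, hk⟩ : ∃ k, Nat.find (hf v) = k + 1 := by
      refine Nat.exists_eq_succ_of_ne_zero fun h => hv ?_
      have := Nat.find_spec (hf v)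
      rwa [h] at this
    have h2 := Nat.find_spec (hf v)
    rw [hk, Function.iterate_succ_apply] at h2
    have := Nat.find_min' (hf (f v)) h2
    omega
  -- Row `v` involves only `v` and its parent, which has strictly smaller depth. Ordering by
  -- decreasing depth makes the matrix block triangular, with identity blocks on the diagonal.
  set b : V → ℕᵒᵈ := fun v => OrderDual.toDual (Nat.find (hf v)) with hb
  have hne : ∀ u v, v ≠ r → b u = b v → u ≠ f v := by
    rintro u v hv huv rfl
    exact (hdec v hv).ne (OrderDual.toDual_inj.mp huv)
  have htri : (parentMatrix r f).BlockTriangular b := by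
    intro v u huv
    have hvu : u ≠ v := by rintro rfl; exact lt_irrefl _ huv
    unfold parentMatrix
    split_ifs with hv
    · subst hv; simp [hvu]
    · have h2 : u ≠ f v := by
        rintro rfl
        exact absurd (hdec v hv) (lt_asymm huv)
      simp [hvu, h2]
  rw [htri.det]
  refine Finset.prod_eq_one fun a _ => ?_
  have : (parentMatrix r f).toSquareBlock b a = 1 := by
    ext ⟨v, hv⟩ ⟨u, hu⟩
    simp only [Matrix.toSquareBlock_def, Matrix.of_apply, parentMatrix, Matrix.one_apply,
      Subtype.mk.injEq]
    split_ifs with h1 h2 h2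
    · subst h1; subst h2; simp
    · subst h1; simp [Ne.symm h2]
    · subst h2; simp [hne v v h1 rfl]
    · simp [Ne.symm h2, hne u v h1 (by rw [hu, hv])]
  rw [this, Matrix.det_one]

/-- The matrix-tree theorem. -/
theorem adjugate_lapMatrix (G : SimpleGraph V) [DecidableRel G.Adj] (r : V) :
    (G.lapMatrix ℤ).adjugate r r = numSpanningTrees G := by
  classical
  -- Each Laplacian row away from the root is a sum of differences over the neighbours.
  -- Multilinearity expands the determinant over choices of one neighbour per vertex; the singleton
  -- at `r` forces the choice to fix the root.
  set S : V → Finset V := fun v => if v = r then {r} else G.neighborFinset v with hS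
  have hrow : (G.lapMatrix ℤ).updateRow r (Pi.single r 1) = fun v => ∑ u ∈ S v,
      (if v = r then Pi.single r 1 else Pi.single v 1 - Pi.single u 1 : V → ℤ) := by
    ext v w
    by_cases hv : v = r
    · subst hv; simp [hS]
    · rw [Matrix.updateRow_ne hv]
      simp only [hS, if_neg hv, Finset.sum_sub_distrib, Finset.sum_const, Pi.sub_apply,
        card_neighborFinset_eq_degree, Finset.sum_apply]
      simp only [lapMatrix, Matrix.sub_apply, degMatrix, Matrix.diagonal_apply, adjMatrix_apply,
        Pi.single_apply, Finset.sum_ite_eq, mem_neighborFinset]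
      congr 1
      by_cases h : v = w
      · subst h; simp
      · simp [h, Ne.symm h]
  rw [Matrix.adjugate_apply, hrow]
  have h1 := (Matrix.detRowAlternating (R := ℤ) (n := V)).toMultilinearMap.map_sum_finset
    (fun v u => (if v = r then Pi.single r 1 else Pi.single v 1 - Pi.single u 1 : V → ℤ)) S
  refine h1.trans ?_
  have h2 : ∀ f ∈ Fintype.piFinset S, (parentMatrix r f).det =
      if IsParentMap G r f then 1 else 0 := by
    intro f hf
    rw [Fintype.mem_piFinset] at hf
    have hroot : f r = r := by simpa [hS] using hf r
    have hadj : ∀ v, v ≠ r → G.Adj v (f v) := fun v hv => by simpa [hS, hv] using hf v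
    by_cases h : ∀ v, ∃ k, f^[k] v = r
    · rw [det_parentMatrix_of_reach h, if_pos ⟨hroot, hadj, h⟩]
    · rw [det_parentMatrix_of_not_reach hroot h, if_neg fun h' => h h'.reach]
  refine (Finset.sum_congr rfl h2).trans ?_
  rw [Finset.sum_boole, numSpanningTrees_eq_card_isParentMap G r, Nat.card_eq_fintype_card,
    Fintype.card_subtype]
  congr 2
  ext f
  simp only [Finset.mem_filter, Fintype.mem_piFinset, Finset.mem_univ, true_and,
    and_iff_right_iff_imp]
  intro h v
  by_cases hv : v = r
  · subst hv; simp [hS, h.root]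
  · simpa [hS, hv] using h.adj v hv

/-- This form of the matrix-tree theorem treats all vertices alike, so it keeps the circulant
symmetry that removing a vertex would destroy. -/
theorem det_lapMatrix_add_const [Nonempty V] (G : SimpleGraph V) [DecidableRel G.Adj] :
    (G.lapMatrix ℤ + Matrix.of fun _ _ => 1).det =
      numSpanningTrees G * (Fintype.card V : ℤ) ^ 2 := by
  obtain ⟨r⟩ := ‹Nonempty V›
  have hr : ∀ i, ∑ j, G.lapMatrix ℤ i j = 0 := fun i => by
    have := congrFun (lapMatrix_mulVec_const_eq_zero (R := ℤ) G) i
    simpa [Matrix.mulVec, dotProduct] using this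
  rw [det_add_const hr (fun j => ?_) 1 r, adjugate_lapMatrix, one_mul, mul_comm]
  rw [← hr j]
  exact Finset.sum_congr rfl fun i _ => ((isSymm_lapMatrix (R := ℤ) G).apply i j).symm

end MatrixTree

/-! ### Arcs and crossings of the Turk's Head diagram -/

section Diagram

variable {m n : ℕ}

theorem succ_mod_div_cases {d : ℕ} (hd : 0 < d) (t : ℕ) :
    (t % d + 1 < d ∧ (t + 1) % d = t % d + 1 ∧ (t + 1) / d = t / d) ∨
      (t % d + 1 = d ∧ (t + 1) % d = 0 ∧ (t + 1) / d = t / d + 1) := by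
  have h1 := Nat.div_add_mod t d
  have h2 := Nat.mod_lt t hd
  rcases Nat.lt_or_eq_of_le (Nat.succ_le_of_lt h2) with h | h
  · left
    have h3 : t + 1 = (t % d + 1) + d * (t / d) := by omega
    refine ⟨h, ?_, ?_⟩
    · rw [h3, Nat.add_mul_mod_self_left, Nat.mod_eq_of_lt h]
    · rw [h3, Nat.add_mul_div_left _ _ hd, Nat.div_eq_of_lt h, zero_add]
  · right
    have h3 : t + 1 = d * (t / d + 1) := by rw [mul_add, mul_one]; omega
    refine ⟨h, ?_, ?_⟩
    · rw [h3, Nat.mul_mod_right]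
    · rw [h3, Nat.mul_div_cancel_left _ hd]

theorem val_left_thk (t : Fin (n * (m - 1))) : ((thk m n t).left : ℕ) = t % (m - 1) := rfl

theorem val_right_thk (t : Fin (n * (m - 1))) : ((thk m n t).right : ℕ) = t % (m - 1) + 1 := rfl

theorem val_overIn_thk (t : Fin (n * (m - 1))) : ((thk m n t).overIn : ℕ) =
    if Even ((t : ℕ) % (m - 1)) then (t : ℕ) % (m - 1) else t % (m - 1) + 1 := by
  by_cases h : Even ((t : ℕ) % (m - 1))
  · rw [if_pos h, BraidLetter.overIn,
      if_pos (show (thk m n t).positive = true from decide_eq_true h), val_left_thk]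
  · rw [if_neg h, BraidLetter.overIn,
      if_neg (show ¬ (thk m n t).positive = true from mt of_decide_eq_true h), val_right_thk]

theorem val_overOut_thk (t : Fin (n * (m - 1))) : ((thk m n t).overOut : ℕ) =
    if Even ((t : ℕ) % (m - 1)) then (t : ℕ) % (m - 1) + 1 else t % (m - 1) := by
  by_cases h : Even ((t : ℕ) % (m - 1))
  · rw [if_pos h, BraidLetter.overOut,
      if_pos (show (thk m n t).positive = true from decide_eq_true h), val_right_thk]
  · rw [if_neg h, BraidLetter.overOut,
      if_neg (show ¬ (thk m n t).positive = true from mt of_decide_eq_true h), val_left_thk]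

/-- The crossing at which the arc through a point passes over, given by its position in the braid
period and by the index of the period: on an even strand position this is the next crossing of that
position, on an odd one it is the last one before. -/
def owner (m n t j : ℕ) : ℕ × ZMod n :=
  if Even j then
    if j = t % (m - 1) then (j, ((t / (m - 1) : ℕ) : ZMod n))
    else (j - 1, ((t / (m - 1) : ℕ) : ZMod n) + if j < t % (m - 1) then 1 else 0)
  else
    if j = t % (m - 1) then (j - 1, ((t / (m - 1) : ℕ) : ZMod n))
    else (min j (m - 2), ((t / (m - 1) : ℕ) : ZMod n) - if t % (m - 1) < j then 1 else 0)

theorem owner_congr {t u : ℕ} (h : t % (m - 1) = u % (m - 1))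
    (h' : ((t / (m - 1) : ℕ) : ZMod n) = ((u / (m - 1) : ℕ) : ZMod n)) (j : ℕ) :
    owner m n t j = owner m n u j := by
  rw [owner, owner, h, h']

/-- The position of a crossing in the braid period and the index of the period. -/
def crossingLabel (m n t : ℕ) : ℕ × ZMod n := (t % (m - 1), ((t / (m - 1) : ℕ) : ZMod n))

theorem owner_overIn (t : Fin (n * (m - 1))) :
    owner m n t (thk m n t).overIn = crossingLabel m n t := by
  rw [val_overIn_thk, owner, crossingLabel]
  by_cases h : Even ((t : ℕ) % (m - 1))
  · simp [h]
  · simp [h, Nat.even_add_one]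

theorem owner_overOut (hm : 3 ≤ m) (t : Fin (n * (m - 1))) :
    owner m n ((t : ℕ) + 1) (thk m n t).overOut = crossingLabel m n t := by
  rw [val_overOut_thk, owner, crossingLabel]
  have hlt := Nat.mod_lt t (show 0 < m - 1 by omega)
  rcases succ_mod_div_cases (show 0 < m - 1 by omega) (t : ℕ) with ⟨h1, h2, h3⟩ | ⟨h1, h2, h3⟩
  · rw [h2, h3]
    by_cases h : Even ((t : ℕ) % (m - 1))
    · simp [h, Nat.even_add_one]
    · have : min ((t : ℕ) % (m - 1)) (m - 2) = t % (m - 1) := by omega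
      simp [h, this]
  · rw [h2, h3]
    by_cases h : Even ((t : ℕ) % (m - 1))
    · have : min ((t : ℕ) % (m - 1) + 1) (m - 2) = t % (m - 1) := by omega
      simp [h, Nat.even_add_one, this]
    · have h4 : min ((t : ℕ) % (m - 1)) (m - 2) = t % (m - 1) := by omega
      have h5 : (t : ℕ) % (m - 1) ≠ 0 := by omega
      simp [h, h4, h5, Nat.pos_of_ne_zero h5]

theorem owner_pass (hm : 3 ≤ m) (t j : ℕ) (hj : j < m) (h1 : j ≠ t % (m - 1))
    (h2 : j ≠ t % (m - 1) + 1) : owner m n t j = owner m n (t + 1) j := by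
  have hlt := Nat.mod_lt t (show 0 < m - 1 by omega)
  rw [owner, owner]
  rcases succ_mod_div_cases (show 0 < m - 1 by omega) (t : ℕ) with ⟨h3, h4, h5⟩ | ⟨h3, h4, h5⟩
  · rw [h4, h5, if_neg h1, if_neg h2, if_neg h1, if_neg h2]
    have e1 : j < t % (m - 1) + 1 ↔ j < t % (m - 1) := by omega
    have e2 : t % (m - 1) + 1 < j ↔ t % (m - 1) < j := by omega
    simp only [e1, e2]
  · rw [h4, h5, if_neg h1, if_neg h1, if_pos (show j < t % (m - 1) by omega),
      if_neg (show ¬ t % (m - 1) < j by omega)]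
    rcases Nat.eq_zero_or_pos j with rfl | hj0
    · simp
    · simp [hj0, hj0.ne']

/-- Over-strands enter crossings at even strand positions and leave at odd ones, so "next crossing"
on even positions and "last crossing" on odd ones name the same crossing all along an arc. Taking
periods in `ZMod n` makes this compatible with closing the braid. -/
theorem owner_step (hm : 3 ≤ m) {p q : Fin (n * (m - 1) + 1) × Fin m}
    (h : ArcStep (thk m n) p q) : owner m n p.1 p.2 = owner m n q.1 q.2 := by
  rcases h with j | ⟨t, j, hl, hr⟩ | t
  · have h1 : n * (m - 1) % (m - 1) = 0 := Nat.mul_mod_left _ _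
    have h2 : n * (m - 1) / (m - 1) = n := Nat.mul_div_cancel n (by omega)
    refine owner_congr (h1.trans (Nat.zero_mod _).symm) ?_ _
    rw [h2, Nat.zero_div, ZMod.natCast_self, Nat.cast_zero]
  · refine owner_pass hm t j j.isLt (fun h => hl (Fin.ext ?_)) (fun h => hr (Fin.ext ?_))
    · rw [val_left_thk]; exact h
    · rw [val_right_thk]; exact h
  · exact (owner_overIn t).trans (owner_overOut hm t).symm

/-- The crossing at which an arc passes over. -/
def Arc.owner (hm : 3 ≤ m) : Arc (thk m n) → ℕ × ZMod n :=
  Quot.lift (fun p => TurksHead.owner m n p.1 p.2) fun _ _ h => owner_step hm h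

theorem Arc.owner_overArc (hm : 3 ≤ m) (t : Fin (n * (m - 1))) :
    (overArc (thk m n) t).owner hm = crossingLabel m n t := owner_overIn t

theorem crossingLabel_injective (t u : Fin (n * (m - 1)))
    (h : crossingLabel m n t = crossingLabel m n u) : t = u := by
  obtain ⟨h1, h2⟩ := Prod.mk.inj h
  have ht : (t : ℕ) / (m - 1) < n := Nat.div_lt_of_lt_mul (t.isLt.trans_eq (mul_comm _ _))
  have hu : (u : ℕ) / (m - 1) < n := Nat.div_lt_of_lt_mul (u.isLt.trans_eq (mul_comm _ _))
  rw [ZMod.natCast_eq_natCast_iff'] at h2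
  rw [Nat.mod_eq_of_lt ht, Nat.mod_eq_of_lt hu] at h2
  apply Fin.ext
  rw [← Nat.div_add_mod (t : ℕ) (m - 1), ← Nat.div_add_mod (u : ℕ) (m - 1), h1, h2]

theorem overArc_injective (hm : 3 ≤ m) : Function.Injective (overArc (thk m n)) := by
  intro t u h
  apply crossingLabel_injective
  rw [← Arc.owner_overArc hm, ← Arc.owner_overArc hm, h]

/-- On an even strand position every crossing met is passed over on entry, so one walks backward
from a crossing, around the closure, to reach any level. On an odd position the over-strand is the
outgoing one, and one walks forward. -/
theorem overArc_surjective (hm : 3 ≤ m) (hn : 0 < n) :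
    Function.Surjective (overArc (thk m n)) := by
  have hL : m - 1 ≤ n * (m - 1) := Nat.le_mul_of_pos_left _ hn
  intro a
  induction a using Quot.ind with
  | mk p =>
  obtain ⟨t, j⟩ := p
  have hclose : arc (thk m n) (Fin.last _) j = arc (thk m n) 0 j := Quot.sound (.close j)
  -- A crossing of the first period that touches position `j`; the minimum treats the last strand,
  -- which is the right-hand side of crossing `m - 2` only.
  let t₀ : Fin (n * (m - 1)) := ⟨min (j : ℕ) (m - 2), by have := j.isLt; omega⟩
  have ht₀ : (t₀ : ℕ) % (m - 1) = min (j : ℕ) (m - 2) := Nat.mod_eq_of_lt (by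
    change min (j : ℕ) (m - 2) < m - 1; omega)
  have htouch : (j : ℕ) = t₀ % (m - 1) ∨ (j : ℕ) = t₀ % (m - 1) + 1 := by
    have := j.isLt
    rw [ht₀]; omega
  have hpass : ∀ t : Fin (n * (m - 1)),
      ¬ ((j : ℕ) = t % (m - 1) ∨ (j : ℕ) = t % (m - 1) + 1) →
        arc (thk m n) t.castSucc j = arc (thk m n) t.succ j := by
    intro t ht
    refine Quot.sound (.pass t j (fun h => ht (Or.inl ?_)) (fun h => ht (Or.inr ?_)))
    · rw [h, val_left_thk]
    · rw [h, val_right_thk]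
  change ∃ s, overArc (thk m n) s = arc (thk m n) t j
  by_cases hj : Even (j : ℕ)
  · have hgood : ∀ t : Fin (n * (m - 1)), ((j : ℕ) = t % (m - 1) ∨ (j : ℕ) = t % (m - 1) + 1) →
        overArc (thk m n) t = arc (thk m n) t.castSucc j := by
      intro t ht
      have : (thk m n t).overIn = j := by
        apply Fin.ext
        rw [val_overIn_thk]
        split_ifs with h <;> rcases ht with e | e
        · exact e.symm
        · rw [e, Nat.even_add_one] at hj; exact absurd h hj
        · rw [e] at hj; exact absurd hj h
        · exact e.symm
      rw [overArc, this]
    have hback : ∀ t : Fin (n * (m - 1)),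
        (∃ s, overArc (thk m n) s = arc (thk m n) t.succ j) →
          ∃ s, overArc (thk m n) s = arc (thk m n) t.castSucc j := by
      intro t ht
      by_cases h : (j : ℕ) = t % (m - 1) ∨ (j : ℕ) = t % (m - 1) + 1
      · exact ⟨t, hgood t h⟩
      · rwa [hpass t h]
    have hzero : ∀ t, (∃ s, overArc (thk m n) s = arc (thk m n) t j) →
        ∃ s, overArc (thk m n) s = arc (thk m n) 0 j := by
      intro t
      induction t using Fin.induction with
      | zero => exact id
      | succ t ih => exact fun h => ih (hback t h)
    have h0 := hzero _ ⟨t₀, hgood t₀ htouch⟩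
    rw [← hclose] at h0
    induction t using Fin.reverseInduction with
    | last => exact h0
    | cast t ih => exact hback t ih
  · have hgood : ∀ t : Fin (n * (m - 1)), ((j : ℕ) = t % (m - 1) ∨ (j : ℕ) = t % (m - 1) + 1) →
        overArc (thk m n) t = arc (thk m n) t.succ j := by
      intro t ht
      have : (thk m n t).overOut = j := by
        apply Fin.ext
        rw [val_overOut_thk]
        split_ifs with h <;> rcases ht with e | e
        · rw [e] at hj; exact absurd h hj
        · exact e.symm
        · exact e.symm
        · rw [e, Nat.even_add_one, not_not] at hj; exact absurd hj h
      rw [← this]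
      exact Quot.sound (ArcStep.over t)
    have hforw : ∀ t : Fin (n * (m - 1)),
        (∃ s, overArc (thk m n) s = arc (thk m n) t.castSucc j) →
          ∃ s, overArc (thk m n) s = arc (thk m n) t.succ j := by
      intro t ht
      by_cases h : (j : ℕ) = t % (m - 1) ∨ (j : ℕ) = t % (m - 1) + 1
      · exact ⟨t, hgood t h⟩
      · rwa [← hpass t h]
    have hlast : ∀ t, (∃ s, overArc (thk m n) s = arc (thk m n) t j) →
        ∃ s, overArc (thk m n) s = arc (thk m n) (Fin.last _) j := by
      intro t
      induction t using Fin.reverseInduction with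
      | last => exact id
      | cast t ih => exact fun h => ih (hforw t h)
    have h0 := hlast _ ⟨t₀, hgood t₀ htouch⟩
    rw [hclose] at h0
    induction t using Fin.induction with
    | zero => exact h0
    | succ t ih => exact hforw t ih

/-- The crossings of the diagram correspond to their positions in the period together with the
index of the period. -/
theorem exists_crossing_equiv (hm : 3 ≤ m) [NeZero n] :
    ∃ e : Fin (m - 1) × ZMod n ≃ Fin (n * (m - 1)),
      ∀ p, crossingLabel m n (e p) = ((p.1 : ℕ), p.2) := by
  have hm' : 0 < m - 1 := by omega
  let f : Fin (n * (m - 1)) → Fin (m - 1) × ZMod n := fun t =>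
    (⟨t % (m - 1), Nat.mod_lt _ hm'⟩, ((t / (m - 1) : ℕ) : ZMod n))
  have hf : ∀ t : Fin (n * (m - 1)), crossingLabel m n t = (((f t).1 : ℕ), (f t).2) := fun t => rfl
  have hinj : f.Injective := fun t u h => crossingLabel_injective t u (by rw [hf, hf, h])
  have hb : f.Bijective := (Fintype.bijective_iff_injective_and_card f).mpr
    ⟨hinj, by simp [ZMod.card, mul_comm]⟩
  refine ⟨(Equiv.ofBijective f hb).symm, fun p => ?_⟩
  rw [hf, show f ((Equiv.ofBijective f hb).symm p) = p from
    (Equiv.ofBijective f hb).apply_symm_apply p]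

/-- The position of the crossing at which the arc ending under a crossing at position `i` passes
over. -/
def inPos (m i : ℕ) : ℕ := if Even i then min (i + 1) (m - 2) else i - 1

/-- The number of periods from a crossing at position `i` to the crossing at which the arc ending
there passes over. -/
def inShift (i : ℕ) : ℤ := if Even i then -1 else 0

/-- The position of the crossing at which the arc starting under a crossing at position `i` passes
over. -/
def outPos (m i : ℕ) : ℕ := if Even i then i - 1 else min (i + 1) (m - 2)

/-- The number of periods from a crossing at position `i` to the crossing at which the arc starting
there passes over. -/
def outShift (m i : ℕ) : ℤ := if Even i then 1 else if i + 1 < m - 1 then 0 else 1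

theorem owner_underIn (hm : 3 ≤ m) (t : Fin (n * (m - 1))) :
    (underArcIn (thk m n) t).owner hm = (inPos m (crossingLabel m n t).1,
      (crossingLabel m n t).2 + inShift (crossingLabel m n t).1) := by
  change owner m n t (thk m n t).overOut = _
  rw [val_overOut_thk, owner, crossingLabel, inPos, inShift]
  by_cases h : Even ((t : ℕ) % (m - 1))
  · simp [h, Nat.even_add_one, sub_eq_add_neg]
  · simp [h]

theorem owner_underOut (hm : 3 ≤ m) (t : Fin (n * (m - 1))) :
    (underArcOut (thk m n) t).owner hm = (outPos m (crossingLabel m n t).1,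
      (crossingLabel m n t).2 + outShift m (crossingLabel m n t).1) := by
  change owner m n ((t : ℕ) + 1) (thk m n t).overIn = _
  have hlt := Nat.mod_lt t (show 0 < m - 1 by omega)
  rw [val_overIn_thk, owner, crossingLabel, outPos, outShift]
  rcases succ_mod_div_cases (show 0 < m - 1 by omega) (t : ℕ) with ⟨h1, h2, h3⟩ | ⟨h1, h2, h3⟩
  · rw [h2, h3]
    by_cases h : Even ((t : ℕ) % (m - 1))
    · simp [h]
    · have : min ((t : ℕ) % (m - 1) + 1) (m - 2) = t % (m - 1) + 1 := by omega
      simp [h, Nat.even_add_one, h1, this]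
  · rw [h2, h3]
    have h5 : (t : ℕ) % (m - 1) ≠ 0 := by omega
    by_cases h : Even ((t : ℕ) % (m - 1))
    · simp [h, h5]
    · have h4 : min (m - 1) (m - 2) = m - 1 - 1 := by omega
      have h6 : Even (m - 1) := by rw [← h1, Nat.even_add_one]; exact h
      have h7 : m - 1 ≠ 0 := by omega
      simp [h, h1, h4, h6, h7]

/-- The entries of the coloring matrix between two periods at distance `d`. -/
def coloringBlock (m n : ℕ) (d : ZMod n) : Matrix (Fin (m - 1)) (Fin (m - 1)) ℤ :=
  Matrix.of fun i j => 2 * (if j = i ∧ d = 0 then 1 else 0)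
    - (if (j : ℕ) = inPos m i ∧ d = inShift i then 1 else 0)
    - (if (j : ℕ) = outPos m i ∧ d = outShift m i then 1 else 0)

/-- The Laplace matrix of a path, extended by a number `y` on the diagonal. -/
def pathLaplacian {R : Type*} [CommRing R] (k : ℕ) (y : R) : Matrix (Fin k) (Fin k) R :=
  tridiagonal (fun i => y + 2 - (if i = 0 then 1 else 0) - if i + 1 = k then 1 else 0)
    (fun _ => -1) (fun _ => -1) k

theorem sum_pathLaplacian_zero_row {k : ℕ} (i : Fin k) :
    ∑ j, pathLaplacian k (0 : ℤ) i j = 0 := by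
  have : ∀ j : Fin k, pathLaplacian k (0 : ℤ) i j = 2 * (if j = i then 1 else 0)
      - (if j = (⟨i - 1, by omega⟩ : Fin k) then 1 else 0)
      - (if j = (⟨min (i + 1) (k - 1), by omega⟩ : Fin k) then 1 else 0) := by
    intro j
    have hi := i.isLt
    have hj := j.isLt
    simp only [pathLaplacian, tridiagonal, Matrix.of_apply, Fin.ext_iff]
    split_ifs <;> first | rfl | omega
  simp [this, Finset.sum_sub_distrib]

theorem pathLaplacian_symm {R : Type*} [CommRing R] {k : ℕ} (y : R) (i j : Fin k) :
    pathLaplacian k y i j = pathLaplacian k y j i := by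
  by_cases h : i = j
  · rw [h]
  · have h' : (i : ℕ) ≠ j := fun e => h (Fin.ext e)
    simp only [pathLaplacian, tridiagonal, Matrix.of_apply]
    split_ifs <;> first | rfl | omega

/-- When periods are forgotten, the under-arcs at position `i` belong to the positions `i - 1` and
`i + 1`, clamped at both ends, which is the Laplacian stencil of a path. Its symmetry later gives
the zero column sums of the coloring matrix. -/
theorem sum_coloringBlock (hm : 3 ≤ m) [NeZero n] (i j : Fin (m - 1)) :
    ∑ d, coloringBlock m n d i j = pathLaplacian (m - 1) 0 i j := by
  have hi := i.isLt
  have hj := j.isLt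
  simp only [coloringBlock, Matrix.of_apply, Finset.sum_sub_distrib, ite_and,
    Finset.sum_ite_irrel, Finset.sum_const_zero, Finset.sum_ite_eq', Finset.mem_univ, if_true,
    ← Finset.mul_sum]
  simp only [pathLaplacian, tridiagonal, Matrix.of_apply, inPos, outPos, Fin.ext_iff]
  split_ifs <;> first | rfl | omega

open Classical in
theorem determinant_thk_mul_sq (hm : 3 ≤ m) [NeZero n] :
    determinant (thk m n) * (n * (m - 1)) ^ 2 =
      (Matrix.of (fun p q : Fin (m - 1) × ZMod n =>
        coloringBlock m n (q.2 - p.2) p.1 q.1 + 1)).det.natAbs := by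
  obtain ⟨e, he⟩ := exists_crossing_equiv (n := n) hm
  let o : Fin (n * (m - 1)) ≃ Arc (thk m n) := Equiv.ofBijective (overArc (thk m n))
    ⟨overArc_injective hm, overArc_surjective hm (NeZero.pos n)⟩
  -- Columns are labelled by the crossing at which the arc passes over, which puts the entries 2 of
  -- the coloring relations on the diagonal.
  let e' := e.trans o
  let := Fintype.ofFinite (Arc (thk m n))
  have heq : ∀ (q : Fin (m - 1) × ZMod n) (a : Arc (thk m n)),
      e' q = a ↔ ((q.1 : ℕ), q.2) = a.owner hm := by
    intro q a
    rw [← he q, ← Arc.owner_overArc hm]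
    refine ⟨fun h => by rw [← h]; rfl, fun h => ?_⟩
    obtain ⟨s, rfl⟩ := overArc_surjective hm (NeZero.pos n) a
    rw [Arc.owner_overArc, Arc.owner_overArc] at h
    change overArc _ _ = _
    rw [crossingLabel_injective _ _ h]
  have hentry : ∀ p q, coloringMatrix (thk m n) (e p) (e' q) =
      coloringBlock m n (q.2 - p.2) p.1 q.1 := by
    intro p q
    simp only [coloringMatrix, coloringBlock, Matrix.of_apply, heq, Arc.owner_overArc,
      owner_underIn, owner_underOut, he, Prod.mk.injEq, sub_eq_iff_eq_add, add_comm _ p.2,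
      Fin.ext_iff, add_zero]
  have hsum_row : ∀ i, ∑ j, coloringMatrix (thk m n) i j = 0 := by
    intro t
    simp [coloringMatrix, Finset.sum_sub_distrib]
  have hsum_col : ∀ j, ∑ i, coloringMatrix (thk m n) i j = 0 := by
    intro a
    obtain ⟨q, rfl⟩ := e'.surjective a
    rw [← Equiv.sum_comp e, Fintype.sum_prod_type]
    simp only [hentry]
    have h1 : ∀ i : Fin (m - 1), ∑ r : ZMod n, coloringBlock m n (q.2 - r) i q.1 =
        pathLaplacian (m - 1) 0 q.1 i := by
      intro i
      rw [pathLaplacian_symm, ← sum_coloringBlock (n := n) hm]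
      exact Equiv.sum_comp (Equiv.subLeft q.2) fun d => coloringBlock m n d i q.1
    rw [Finset.sum_congr rfl fun i _ => h1 i, sum_pathLaplacian_zero_row]
  have hpos : 0 < n * (m - 1) := Nat.mul_pos (NeZero.pos n) (by omega)
  have hcard : Fintype.card (Fin (m - 1) × ZMod n) = (n * (m - 1) - 1) + 1 := by
    rw [Fintype.card_prod, ZMod.card, Fintype.card_fin, Nat.sub_add_cancel hpos, mul_comm]
  have hmain := gcd_minors_mul_sq (coloringMatrix (thk m n)) hsum_row hsum_col e e' _ hcard
  rw [Nat.sub_add_cancel hpos] at hmain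
  have hN : Nat.card (Arc (thk m n)) = n * (m - 1) := by
    rw [← Nat.card_congr o, Nat.card_eq_fintype_card, Fintype.card_fin]
  unfold determinant
  rw [hN]
  refine hmain.trans ?_
  congr 2
  ext p q
  simp [hentry]

end Diagram

/-! ### Fourier transform of the coloring matrix and Chebyshev recurrences -/

section Transform

variable {m n : ℕ}

/-- The added ones are constant in `d`, so a nontrivial character sums them to zero; the trivial
character collects `n` in each entry. -/
theorem det_block_add_one [NeZero n] {ι : Type*} [Fintype ι] [DecidableEq ι]
    (B : ZMod n → Matrix ι ι ℤ) :
    (((Matrix.of fun p q : ι × ZMod n => B (q.2 - p.2) p.1 q.1 + 1).det : ℤ) : ℂ) =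
      (Matrix.of fun i j => (∑ d, (B d i j : ℂ)) + n).det *
        ∏ h ∈ Finset.univ.erase (0 : ZMod n),
          (Matrix.of fun i j => ∑ d, ZMod.stdAddChar (d * h) * (B d i j : ℂ)).det := by
  have h1 := det_blockCirculant (n := n) (ι := ι) fun d => Matrix.of fun i j => (B d i j : ℂ) + 1
  rw [← Finset.mul_prod_erase Finset.univ _ (Finset.mem_univ (0 : ZMod n))] at h1
  refine ((Int.castRingHom ℂ).map_det _).trans (Eq.trans ?_ (h1.trans ?_))
  · congr 1
    ext p q
    simp
  · congr 1
    · congr 1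
      ext i j
      simp [Matrix.sum_apply, Finset.sum_add_distrib, ZMod.card]
    · refine Finset.prod_congr rfl fun h hh => ?_
      congr 1
      ext i j
      have h2 := AddChar.sum_mulShift (R' := ℂ) h (ZMod.isPrimitive_stdAddChar n)
      rw [if_neg (Finset.ne_of_mem_erase hh), Nat.cast_zero] at h2
      simp [Matrix.sum_apply, mul_add, Finset.sum_add_distrib, h2]

/-- The Chebyshev polynomials of the second kind, rescaled and shifted by one:
`sineSeq (2 cos θ) k = sin (k θ) / sin θ`. -/
def sineSeq {R : Type*} [CommRing R] (x : R) : ℕ → R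
  | 0 => 0
  | 1 => 1
  | k + 2 => x * sineSeq x (k + 1) - sineSeq x k

theorem sineSeq_add_two {R : Type*} [CommRing R] (x : R) (k : ℕ) :
    sineSeq x (k + 2) = x * sineSeq x (k + 1) - sineSeq x k := rfl

theorem map_sineSeq {R S : Type*} [CommRing R] [CommRing S] (f : R →+* S) (x : R) (k : ℕ) :
    f (sineSeq x k) = sineSeq (f x) k := by
  induction k using Nat.twoStepInduction with
  | zero => simp [sineSeq]
  | one => simp [sineSeq]
  | more k h1 h2 => rw [sineSeq_add_two, sineSeq_add_two, map_sub, map_mul, h1, h2]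

theorem det_tridiagonal_path_prefix {R : Type*} [CommRing R] (y : R) (k : ℕ) :
    (tridiagonal (fun i => y + 2 - if i = 0 then 1 else 0) (fun _ => -1) (fun _ => -1) k).det =
      sineSeq (y + 2) (k + 1) - sineSeq (y + 2) k := by
  induction k using Nat.twoStepInduction with
  | zero => simp [sineSeq]
  | one => rw [det_tridiagonal_one]; simp [sineSeq]
  | more k h1 h2 =>
    rw [det_tridiagonal_add_two, h1, h2, sineSeq_add_two _ (k + 1), sineSeq_add_two _ k]
    simp
    ring

theorem det_pathLaplacian {R : Type*} [CommRing R] (y : R) (k : ℕ) :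
    (pathLaplacian (k + 1) y).det = y * sineSeq (y + 2) (k + 1) := by
  cases k with
  | zero => rw [pathLaplacian, det_tridiagonal_one]; simp [sineSeq]; ring
  | succ k =>
    have h1 : ∀ l, l < k + 2 →
        tridiagonal (fun i => y + 2 - (if i = 0 then 1 else 0) - if i + 1 = k + 2 then 1 else 0)
          (fun _ => -1) (fun _ => -1) l =
        tridiagonal (fun i => y + 2 - if i = 0 then 1 else 0) (fun _ => -1) (fun _ => -1) l := by
      intro l hl
      refine tridiagonal_congr (fun i hi => ?_) (fun _ _ => rfl) (fun _ _ => rfl)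
      rw [if_neg (show ¬ i + 1 = k + 2 by omega), sub_zero]
    rw [pathLaplacian, det_tridiagonal_add_two, h1 _ (by omega), h1 _ (by omega),
      det_tridiagonal_path_prefix, det_tridiagonal_path_prefix, sineSeq_add_two]
    simp
    ring

theorem sineSeq_two {R : Type*} [CommRing R] (k : ℕ) : sineSeq (2 : R) k = k := by
  induction k using Nat.twoStepInduction with
  | zero => simp [sineSeq]
  | one => simp [sineSeq]
  | more k h1 h2 => rw [sineSeq_add_two, h1, h2]; push_cast; ring

theorem intCast_pathLaplacian {R : Type*} [CommRing R] {k : ℕ} (i j : Fin k) :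
    ((pathLaplacian k (0 : ℤ) i j : ℤ) : R) = pathLaplacian k 0 i j := by
  simp only [pathLaplacian, tridiagonal, Matrix.of_apply]
  split_ifs <;> norm_num

/-- The cofactor of a path Laplacian is 1, since `sineSeq 2 k = k` makes the prefix determinant
equal to `(k + 1) - k`. -/
theorem det_pathLaplacian_add_const {R : Type*} [CommRing R] [IsDomain R] (t : R) {k : ℕ}
    (hk : 0 < k) :
    (pathLaplacian k 0 + Matrix.of fun _ _ => t).det = t * (k : R) ^ 2 := by
  obtain ⟨k, rfl⟩ := Nat.exists_eq_succ_of_ne_zero hk.ne'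
  have hr : ∀ i, ∑ j, pathLaplacian (k + 1) (0 : R) i j = 0 := by
    intro i
    have h := congrArg (Int.cast (R := R)) (sum_pathLaplacian_zero_row i)
    rw [Int.cast_sum, Int.cast_zero] at h
    exact (Finset.sum_congr rfl fun j _ => (intCast_pathLaplacian i j).symm).trans h
  have hc : ∀ j, ∑ i, pathLaplacian (k + 1) (0 : R) i j = 0 := fun j =>
    (Finset.sum_congr rfl fun i _ => pathLaplacian_symm _ _ _).trans (hr j)
  have hsub : (pathLaplacian (k + 1) (0 : R)).submatrix (Fin.last k).succAbove
      (Fin.last k).succAbove =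
      tridiagonal (fun i => 0 + 2 - if i = 0 then 1 else 0) (fun _ => -1) (fun _ => -1) k := by
    ext i j
    have := i.isLt
    simp only [pathLaplacian, tridiagonal, Matrix.submatrix_apply, Fin.succAbove_last,
      Matrix.of_apply, Fin.val_castSucc]
    rw [if_neg (show ¬ (i : ℕ) + 1 = k + 1 by omega), sub_zero]
  rw [det_add_const hr hc t (Fin.last k), Matrix.adjugate_fin_succ_eq_det_submatrix, hsub,
    det_tridiagonal_path_prefix, zero_add, sineSeq_two, sineSeq_two]
  simp [← two_mul, pow_mul]

theorem det_block_add_one_of_sum_eq_pathLaplacian [NeZero n] {k : ℕ} (hk : 0 < k)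
    (B : ZMod n → Matrix (Fin k) (Fin k) ℤ)
    (hB : ∀ i j, ∑ d, B d i j = pathLaplacian k 0 i j) :
    (((Matrix.of fun p q : Fin k × ZMod n => B (q.2 - p.2) p.1 q.1 + 1).det : ℤ) : ℂ) =
      n * (k : ℂ) ^ 2 * ∏ h ∈ Finset.univ.erase (0 : ZMod n),
          (Matrix.of fun i j => ∑ d, ZMod.stdAddChar (d * h) * (B d i j : ℂ)).det := by
  rw [det_block_add_one, ← det_pathLaplacian_add_const (n : ℂ) hk]
  congr 2
  ext i j
  rw [Matrix.of_apply, Matrix.add_apply, Matrix.of_apply, ← Int.cast_sum, hB, intCast_pathLaplacian]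

/-- The coloring matrix of one period, twisted by a root of unity `z` with inverse `w`. -/
def twistedColoring {R : Type*} [CommRing R] (m : ℕ) (z w : R) :
    Matrix (Fin (m - 1)) (Fin (m - 1)) R :=
  tridiagonal
    (fun i => 2 - (if i = 0 then z else 0) -
      if i + 1 = m - 1 then (if Even i then w else z) else 0)
    (fun i => if Even i then -w else -1) (fun i => if Even i then -1 else -z) (m - 1)

theorem sum_stdAddChar_mul_coloringBlock (hm : 3 ≤ m) [NeZero n] (h : ZMod n) :
    (Matrix.of fun i j => ∑ d, ZMod.stdAddChar (d * h) * (coloringBlock m n d i j : ℂ)) =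
      twistedColoring m (ZMod.stdAddChar h) (ZMod.stdAddChar (-h)) := by
  ext i j
  have hi := i.isLt
  have hj := j.isLt
  simp only [coloringBlock, Matrix.of_apply, Int.cast_sub, Int.cast_ite,
    Int.cast_ofNat, Int.cast_one, Int.cast_zero, mul_sub, Finset.sum_sub_distrib, ite_and,
    mul_ite, mul_zero, mul_one, Finset.sum_ite_irrel, Finset.sum_const_zero, Finset.sum_ite_eq',
    Finset.mem_univ, if_true]
  simp only [twistedColoring, tridiagonal, Matrix.of_apply, inPos, outPos, inShift, outShift,
    Fin.ext_iff]
  by_cases he : Even (i : ℕ)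
  · have he' : ∀ l : ℕ, l + 1 = i → ¬ Even l := fun l hl hl' => by
      rw [← hl, Nat.even_add_one] at he; exact he hl'
    simp only [he, if_true]
    split_ifs <;> first | omega | (simp; done) | (exfalso; apply he' _ _ ‹_›; omega)
  · have he' : ∀ l : ℕ, l + 1 = i → Even l := fun l hl => by
      rw [← hl, Nat.even_add_one, not_not] at he; exact he
    have hi0 : (i : ℕ) ≠ 0 := fun h0 => he (by rw [h0]; exact Even.zero)
    simp only [he, if_false]
    split_ifs <;> first | omega | (simp; done) | (exfalso; apply ‹¬ Even _›; apply he'; omega)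

/-- The products of opposite off-diagonal entries alternate between `w` and `z`. Two steps of the
recurrence together have trace `4 - z - w` and determinant `z * w = 1`, so every second prefix
determinant satisfies the recurrence of `sineSeq (4 - z - w)`. -/
theorem det_twistedColoring_prefix {R : Type*} [CommRing R] {z w : R} (hzw : z * w = 1) (j : ℕ) :
    (tridiagonal (fun i => 2 - if i = 0 then z else 0) (fun i => if Even i then -w else -1)
      (fun i => if Even i then -1 else -z) (2 * j)).det =
        sineSeq (4 - z - w) (j + 1) - z * sineSeq (4 - z - w) j ∧
    (tridiagonal (fun i => 2 - if i = 0 then z else 0) (fun i => if Even i then -w else -1)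
      (fun i => if Even i then -1 else -z) (2 * j + 1)).det =
        (2 - z) * sineSeq (4 - z - w) (j + 1) - sineSeq (4 - z - w) j := by
  induction j with
  | zero =>
    refine ⟨by simp [sineSeq], ?_⟩
    rw [mul_zero, zero_add, det_tridiagonal_one]
    simp [sineSeq]
  | succ j ih =>
    obtain ⟨h1, h2⟩ := ih
    have h3 : (tridiagonal (fun i => 2 - if i = 0 then z else 0)
        (fun i => if Even i then -w else -1)
        (fun i => if Even i then -1 else -z) (2 * (j + 1))).det =
          sineSeq (4 - z - w) (j + 1 + 1) - z * sineSeq (4 - z - w) (j + 1) := by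
      rw [show 2 * (j + 1) = 2 * j + 2 by ring, det_tridiagonal_add_two, h1, h2,
        sineSeq_add_two _ j]
      simp
      linear_combination sineSeq (4 - z - w) j * hzw
    refine ⟨h3, ?_⟩
    rw [show 2 * (j + 1) + 1 = 2 * j + 1 + 2 by ring, det_tridiagonal_add_two, h2,
      show 2 * j + 1 + 1 = 2 * (j + 1) by ring, h3, sineSeq_add_two _ j]
    simp
    linear_combination -sineSeq (4 - z - w) (j + 1) * hzw

/-- With `y = 2 - z - w` this is the value found in `det_pathLaplacian` for a path on half as many
vertices as there are strands; this coincidence links the knot with the grid. -/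
theorem det_twistedColoring_even {R : Type*} [CommRing R] {z w : R} (hzw : z * w = 1) (j : ℕ) :
    (twistedColoring (2 * (j + 2)) z w).det = (2 - z - w) * sineSeq (4 - z - w) (j + 2) := by
  have h1 : ∀ l, l < 2 * j + 3 →
      tridiagonal (fun i => 2 - (if i = 0 then z else 0) -
        if i + 1 = 2 * j + 1 + 2 then (if Even i then w else z) else 0)
        (fun i => if Even i then -w else -1) (fun i => if Even i then -1 else -z) l =
      tridiagonal (fun i => 2 - if i = 0 then z else 0)
        (fun i => if Even i then -w else -1) (fun i => if Even i then -1 else -z) l := by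
    intro l hl
    refine tridiagonal_congr (fun i hi => ?_) (fun _ _ => rfl) (fun _ _ => rfl)
    rw [if_neg (show ¬ i + 1 = 2 * j + 1 + 2 by omega), sub_zero]
  have h2 : 2 * (j + 2) - 1 = 2 * j + 1 + 2 := by omega
  obtain ⟨h3, h4⟩ := det_twistedColoring_prefix hzw j
  obtain ⟨h5, -⟩ := det_twistedColoring_prefix hzw (j + 1)
  rw [twistedColoring, h2, det_tridiagonal_add_two, h1 _ (by omega), h1 _ (by omega), h4,
    show 2 * j + 1 + 1 = 2 * (j + 1) by ring, h5, sineSeq_add_two _ j]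
  have h6 : Even (2 * (j + 1)) := even_two_mul _
  have h7 : ¬ Even (2 * j + 1) := by simp
  have h8 : 2 * (j + 1) + 1 = 2 * j + 1 + 2 := by ring
  have h9 : ¬ 2 * (j + 1) = 0 := by omega
  simp only [if_pos h6, if_neg h7, if_pos h8, if_neg h9]
  ring

theorem det_twistedColoring_three {R : Type*} [CommRing R] {z w : R} (hzw : z * w = 1) :
    (twistedColoring 3 z w).det = (1 - z) * (3 - z - w) := by
  rw [twistedColoring, show 3 - 1 = 0 + 2 from rfl, det_tridiagonal_add_two,
    det_tridiagonal_one, det_tridiagonal_zero]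
  simp
  linear_combination (-1 : R) * hzw

end Transform

/-! ### Laplacians of the grid and of the wheel -/

section Graphs

/-- Two matrices with zero row sums that agree off the diagonal are equal. -/
theorem matrix_eq_of_sum_row_eq_zero {κ R : Type*} [Fintype κ] [CommRing R]
    {A B : Matrix κ κ R} (hA : ∀ i, ∑ j, A i j = 0) (hB : ∀ i, ∑ j, B i j = 0)
    (h : ∀ i j, i ≠ j → A i j = B i j) : A = B := by
  classical
  ext i j
  by_cases hij : i = j
  · subst hij
    have h1 := hA i
    rw [← hB i, ← Finset.add_sum_erase _ _ (Finset.mem_univ i),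
      ← Finset.add_sum_erase _ (B i) (Finset.mem_univ i)] at h1
    rw [Finset.sum_congr rfl fun k hk => h i k (Finset.ne_of_mem_erase hk).symm] at h1
    exact add_right_cancel h1
  · exact h i j hij

theorem sum_lapMatrix {V : Type*} [Fintype V] [DecidableEq V] (G : SimpleGraph V)
    [DecidableRel G.Adj] (v : V) : ∑ w, G.lapMatrix ℤ v w = 0 := by
  have := congrFun (lapMatrix_mulVec_const_eq_zero (R := ℤ) G) v
  simpa [Matrix.mulVec, dotProduct] using this

theorem lapMatrix_of_ne {V : Type*} [Fintype V] [DecidableEq V] (G : SimpleGraph V)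
    [DecidableRel G.Adj] {v w : V} (h : v ≠ w) :
    G.lapMatrix ℤ v w = -if G.Adj v w then 1 else 0 := by
  simp [lapMatrix, degMatrix, Matrix.diagonal_apply_ne _ h, adjMatrix_apply]

variable {n : ℕ}

/-- The entries of the Laplace matrix of the product of a cycle and a path between two vertices of
the cycle at distance `d`. -/
def gridBlock (k n : ℕ) (d : ZMod n) : Matrix (Fin k) (Fin k) ℤ :=
  Matrix.of fun i j => (if d = 0 then pathLaplacian k 2 i j else 0)
    - (if j = i ∧ d = 1 then 1 else 0) - (if j = i ∧ d = -1 then 1 else 0)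

theorem pathLaplacian_sub_diagonal {R : Type*} [CommRing R] (k : ℕ) (y x : R) (i j : Fin k) :
    pathLaplacian k y i j - (if j = i then x else 0) = pathLaplacian k (y - x) i j := by
  simp only [pathLaplacian, tridiagonal, Matrix.of_apply, Fin.ext_iff]
  split_ifs <;> first | omega | ring

theorem sum_gridBlock [NeZero n] (k : ℕ) (i j : Fin k) :
    ∑ d, gridBlock k n d i j = pathLaplacian k 0 i j := by
  simp only [gridBlock, Matrix.of_apply, Finset.sum_sub_distrib, ite_and,
    Finset.sum_ite_irrel, Finset.sum_const_zero, Finset.sum_ite_eq', Finset.mem_univ, if_true]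
  rw [pathLaplacian_sub_diagonal, pathLaplacian_sub_diagonal]
  norm_num

theorem sum_stdAddChar_mul_gridBlock [NeZero n] (k : ℕ) (h : ZMod n) :
    (Matrix.of fun i j => ∑ d, ZMod.stdAddChar (d * h) * (gridBlock k n d i j : ℂ)) =
      pathLaplacian k (2 - ZMod.stdAddChar h - ZMod.stdAddChar (-h)) := by
  ext i j
  simp only [gridBlock, Matrix.of_apply, Int.cast_sub, Int.cast_ite,
    Int.cast_one, Int.cast_zero, mul_sub, Finset.sum_sub_distrib, ite_and,
    mul_ite, mul_zero, mul_one, Finset.sum_ite_irrel, Finset.sum_const_zero, Finset.sum_ite_eq',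
    Finset.mem_univ, if_true, zero_mul, one_mul, neg_mul, AddChar.map_zero_eq_one]
  have h2 : ((pathLaplacian k (2 : ℤ) i j : ℤ) : ℂ) = pathLaplacian k 2 i j := by
    simp only [pathLaplacian, tridiagonal, Matrix.of_apply]
    split_ifs <;> norm_num
  rw [h2, pathLaplacian_sub_diagonal, pathLaplacian_sub_diagonal]

theorem sum_row_circulant [NeZero n] {k : ℕ} (B : ZMod n → Matrix (Fin k) (Fin k) ℤ)
    (p : Fin k × ZMod n) :
    ∑ q : Fin k × ZMod n, B (q.2 - p.2) p.1 q.1 = ∑ j, ∑ d, B d p.1 j := by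
  rw [Fintype.sum_prod_type]
  exact Finset.sum_congr rfl fun j _ => Equiv.sum_comp (Equiv.subRight p.2) fun d => B d p.1 j

theorem cycleGraph_adj_finEquiv (n : ℕ) (a b : ZMod (n + 3)) :
    (cycleGraph (n + 3)).Adj ((ZMod.finEquiv (n + 3)).symm a) ((ZMod.finEquiv (n + 3)).symm b) ↔
      a - b = 1 ∨ b - a = 1 := by
  rw [cycleGraph_adj, ← map_sub, ← map_sub, map_eq_one_iff _ (RingEquiv.injective _),
    map_eq_one_iff _ (RingEquiv.injective _)]

-- A cycle of length at least 3 is needed so that 1, -1 and 0 are distinct in `ZMod (n + 3)` and no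
-- two edges coincide.
open Classical in
theorem gridBlock_of_ne (n k : ℕ) (p q : Fin k × ZMod (n + 3)) (h : p ≠ q) :
    gridBlock k (n + 3) (q.2 - p.2) p.1 q.1 =
      -if ((p.2 - q.2 = 1 ∨ q.2 - p.2 = 1) ∧ p.1 = q.1) ∨
        ((pathGraph k).Adj p.1 q.1 ∧ p.2 = q.2) then 1 else 0 := by
  obtain ⟨i, a⟩ := p
  obtain ⟨j, b⟩ := q
  have h1 : (1 : ZMod (n + 3)) ≠ 0 := by
    intro e
    rw [← Nat.cast_one, ZMod.natCast_eq_zero_iff] at e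
    exact absurd (Nat.le_of_dvd one_pos e) (by omega)
  have h2 : (1 : ZMod (n + 3)) ≠ -1 := by
    intro e
    have e2 : ((2 : ℕ) : ZMod (n + 3)) = 0 := by
      push_cast
      linear_combination e
    rw [ZMod.natCast_eq_zero_iff] at e2
    exact absurd (Nat.le_of_dvd two_pos e2) (by omega)
  simp only [gridBlock, Matrix.of_apply, pathGraph_adj]
  by_cases hab : a = b
  · subst hab
    have hij : i ≠ j := fun e => h (by rw [e])
    have hij' : (i : ℕ) ≠ j := fun e => hij (Fin.ext e)
    simp only [sub_self, if_true, h1.symm, and_false, false_and, or_false, false_or, and_true,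
      hij.symm, sub_zero, if_false]
    simp only [pathLaplacian, tridiagonal, Matrix.of_apply]
    split_ifs <;> first | rfl | omega
  · have hba : b - a ≠ 0 := sub_ne_zero.mpr (Ne.symm hab)
    have hneg : a - b = 1 ↔ b - a = -1 := by rw [← neg_sub, neg_eq_iff_eq_neg]
    simp only [hba, if_false, hab, and_false, or_false, hneg]
    by_cases hij : i = j
    · subst hij
      by_cases h3 : b - a = 1
      · simp [h3, h2]
      · by_cases h4 : b - a = -1
        · simp [h4, h2.symm]
        · simp [h3, h4]
    · simp [hij, Ne.symm hij]

theorem numSpanningTrees_grid_mul_sq (n k : ℕ) (hk : 0 < k) :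
    numSpanningTrees (cycleGraph (n + 3) □ pathGraph k) * ((n + 3 : ℕ) * (k : ℤ)) ^ 2 =
      (Matrix.of fun p q : Fin k × ZMod (n + 3) =>
        gridBlock k (n + 3) (q.2 - p.2) p.1 q.1 + 1).det := by
  classical
  have : NeZero k := ⟨hk.ne'⟩
  let e : Fin k × ZMod (n + 3) ≃ Fin (n + 3) × Fin k :=
    (Equiv.prodComm _ _).trans
      (Equiv.prodCongr (ZMod.finEquiv (n + 3)).symm.toEquiv (Equiv.refl _))
  have h1 := det_lapMatrix_add_const (cycleGraph (n + 3) □ pathGraph k)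
  rw [Fintype.card_prod, Fintype.card_fin, Fintype.card_fin, Nat.cast_mul] at h1
  rw [← h1, ← Matrix.det_submatrix_equiv_self e]
  congr 1
  have h2 : ((cycleGraph (n + 3) □ pathGraph k).lapMatrix ℤ).submatrix e e =
      Matrix.of fun p q : Fin k × ZMod (n + 3) =>
        gridBlock k (n + 3) (q.2 - p.2) p.1 q.1 := by
    refine matrix_eq_of_sum_row_eq_zero (fun p => ?_) (fun p => ?_) (fun p q hpq => ?_)
    · exact (Equiv.sum_comp e _).trans (sum_lapMatrix _ (e p))
    · refine (sum_row_circulant (gridBlock k (n + 3)) p).trans ?_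
      rw [Finset.sum_congr rfl fun j _ => sum_gridBlock k p.1 j, sum_pathLaplacian_zero_row]
    · rw [Matrix.submatrix_apply, lapMatrix_of_ne _ (e.injective.ne hpq), Matrix.of_apply,
        gridBlock_of_ne n k p q hpq]
      congr 1
      refine if_congr ?_ rfl rfl
      rw [boxProd_adj, ← cycleGraph_adj_finEquiv, ← (ZMod.finEquiv (n + 3)).symm.injective.eq_iff
        (a := p.2)]
      rfl
  ext p q
  have := congrFun (congrFun h2 p) q
  simp only [Matrix.submatrix_apply, Matrix.of_apply, Matrix.add_apply] at this ⊢
  rw [this]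

theorem det_updateRow_none {α R : Type*} [Fintype α] [DecidableEq α] [CommRing R]
    (M : Matrix (Option α) (Option α) R) :
    (M.updateRow none (Pi.single none 1)).det = (M.submatrix some some).det := by
  rw [← Matrix.det_submatrix_equiv_self (Equiv.optionEquivSumPUnit.{0} α).symm]
  have : (M.updateRow none (Pi.single none 1)).submatrix (Equiv.optionEquivSumPUnit.{0} α).symm
      (Equiv.optionEquivSumPUnit.{0} α).symm =
      Matrix.fromBlocks (M.submatrix some some) (Matrix.of fun i _ => M (some i) none) 0 1 := by
    ext i j
    rcases i with i | i <;> rcases j with j | j <;>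
      simp [Matrix.updateRow_apply]
  rw [this, Matrix.det_fromBlocks_zero₂₁, Matrix.det_one, mul_one]

theorem numSpanningTrees_wheelGraph (n : ℕ) :
    (numSpanningTrees (wheelGraph (n + 3)) : ℂ) =
      ∏ h : ZMod (n + 3), (3 - ZMod.stdAddChar h - ZMod.stdAddChar (-h)) := by
  classical
  have h1 := adjugate_lapMatrix (wheelGraph (n + 3)) none
  rw [Matrix.adjugate_apply, det_updateRow_none] at h1
  let e : Fin 1 × ZMod (n + 3) ≃ Fin (n + 3) :=
    (Equiv.uniqueProd _ _).trans (ZMod.finEquiv (n + 3)).symm.toEquiv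
  rw [← Matrix.det_submatrix_equiv_self e] at h1
  -- Deleting the hub leaves the Laplacian of the cycle, seen as a grid over a one-vertex path, plus
  -- the identity coming from the spokes.
  set B : ZMod (n + 3) → Matrix (Fin 1) (Fin 1) ℤ :=
    fun d => gridBlock 1 (n + 3) d + if d = 0 then 1 else 0 with hB
  have hsum : ∀ i j, ∑ d, (if d = (0 : ZMod (n + 3)) then (1 : Matrix (Fin 1) (Fin 1) ℤ)
      else 0) i j = 1 := by
    intro i j
    rw [← Matrix.sum_apply, Finset.sum_ite_eq', if_pos (Finset.mem_univ _),
      Subsingleton.elim i j, Matrix.one_apply_eq]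
  -- Subtracting the identity makes the row sums zero, so that only off-diagonal entries need
  -- comparison.
  have h2 : (((wheelGraph (n + 3)).lapMatrix ℤ).submatrix some some).submatrix e e - 1 =
      (Matrix.of fun p q : Fin 1 × ZMod (n + 3) => B (q.2 - p.2) p.1 q.1) - 1 := by
    refine matrix_eq_of_sum_row_eq_zero (fun p => ?_) (fun p => ?_) (fun p q hpq => ?_)
    · simp only [Matrix.sub_apply, Finset.sum_sub_distrib, Matrix.submatrix_apply,
        Matrix.one_apply, Finset.sum_ite_eq, Finset.mem_univ, if_true]
      have h3 := sum_lapMatrix (wheelGraph (n + 3)) (some (e p))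
      rw [Fintype.sum_option, lapMatrix_of_ne _ (by simp), if_pos (by trivial),
        ← Equiv.sum_comp e] at h3
      linear_combination h3
    · simp only [Matrix.sub_apply, Finset.sum_sub_distrib, Matrix.of_apply,
        Matrix.one_apply, Finset.sum_ite_eq, Finset.mem_univ, if_true]
      rw [sum_row_circulant B p]
      simp only [hB, Matrix.add_apply, Finset.sum_add_distrib, sum_gridBlock, hsum,
        sum_pathLaplacian_zero_row]
      simp
    · have hne : q.2 - p.2 ≠ 0 := by
        rw [Ne, sub_eq_zero]
        exact fun e' => hpq (Prod.ext (Subsingleton.elim _ _) e'.symm)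
      rw [Matrix.sub_apply, Matrix.sub_apply, Matrix.one_apply_ne hpq, Matrix.of_apply,
        Matrix.submatrix_apply, Matrix.submatrix_apply,
        lapMatrix_of_ne _ (by simpa using e.injective.ne hpq), hB]
      simp only [Matrix.add_apply, if_neg hne, Matrix.zero_apply, add_zero]
      rw [gridBlock_of_ne n 1 p q hpq]
      rw [sub_left_inj, neg_inj]
      refine if_congr ?_ rfl rfl
      rw [← cycleGraph_adj_finEquiv]
      have : p.1 = q.1 := Subsingleton.elim _ _
      simp only [this, and_true, SimpleGraph.irrefl, false_and, or_false]
      rfl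
  rw [sub_left_inj] at h2
  rw [h2] at h1
  have h4 := det_blockCirculant (n := n + 3) (ι := Fin 1)
    fun d => Matrix.of fun i j => (B d i j : ℂ)
  have h5 := congrArg (Int.cast (R := ℂ)) h1
  rw [Int.cast_natCast] at h5
  rw [← h5]
  refine ((Int.castRingHom ℂ).map_det _).trans (Eq.trans ?_ (h4.trans ?_))
  · congr 1
  · refine Finset.prod_congr rfl fun h _ => ?_
    have h6 := congrFun (congrFun (sum_stdAddChar_mul_gridBlock (n := n + 3) 1 h) 0) 0
    rw [Matrix.det_fin_one, Matrix.sum_apply]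
    simp only [hB, Matrix.smul_apply, Matrix.of_apply, Matrix.add_apply, Int.cast_add, smul_eq_mul,
      mul_add, Finset.sum_add_distrib]
    simp only [Matrix.of_apply] at h6
    rw [h6]
    have h7 : ∀ d : ZMod (n + 3), ZMod.stdAddChar (d * h) *
        (((if d = 0 then (1 : Matrix (Fin 1) (Fin 1) ℤ) else 0) 0 0 : ℤ) : ℂ) =
          if d = 0 then 1 else 0 := by
      intro d
      split_ifs with hd
      · rw [hd]; simp
      · simp
    rw [Finset.sum_congr rfl fun d _ => h7 d]
    simp [pathLaplacian, tridiagonal]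
    ring

end Graphs

/-! ### Products over roots of unity and sine products -/

section Evaluation

variable {n : ℕ}

theorem prod_erase_zero_zmod [NeZero n] {M : Type*} [CommMonoid M] (F : ZMod n → M) :
    ∏ h ∈ Finset.univ.erase (0 : ZMod n), F h = ∏ j ∈ Finset.Icc 1 (n - 1), F (j : ZMod n) := by
  refine Finset.prod_bij' (fun h _ => h.val) (fun j _ => (j : ZMod n)) ?_ ?_ ?_ ?_ ?_
  · intro h hh
    have h1 := ZMod.val_lt h
    have h2 : h.val ≠ 0 := fun e => Finset.ne_of_mem_erase hh ((ZMod.val_eq_zero h).mp e)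
    exact Finset.mem_Icc.mpr ⟨by omega, by omega⟩
  · intro j hj
    rw [Finset.mem_Icc] at hj
    refine Finset.mem_erase.mpr ⟨fun e => ?_, Finset.mem_univ _⟩
    rw [ZMod.natCast_eq_zero_iff] at e
    exact absurd (Nat.le_of_dvd (by omega) e) (by omega)
  · intro h _; exact ZMod.natCast_zmod_val h
  · intro j hj
    rw [Finset.mem_Icc] at hj
    exact ZMod.val_natCast_of_lt (by omega)
  · intro h _; rw [ZMod.natCast_zmod_val]

theorem prod_Icc_one_eq_prod_range {M : Type*} [CommMonoid M] (f : ℕ → M) (k : ℕ) :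
    ∏ l ∈ Finset.Icc 1 k, f l = ∏ l ∈ Finset.range k, f (l + 1) := by
  induction k with
  | zero => simp
  | succ k ih => rw [Finset.prod_Icc_succ_top (by omega), ih, Finset.prod_range_succ]

theorem stdAddChar_mul_neg [NeZero n] (h : ZMod n) :
    ZMod.stdAddChar h * ZMod.stdAddChar (-h) = 1 := by
  rw [← AddChar.map_add_eq_mul, add_neg_cancel, AddChar.map_zero_eq_one]

theorem prod_stdAddChar [NeZero n] (f : ℂ → ℂ) :
    ∏ h : ZMod n, f (ZMod.stdAddChar h) = ∏ z ∈ Polynomial.nthRootsFinset n (1 : ℂ), f z := by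
  classical
  have himg : Finset.univ.image (ZMod.stdAddChar : ZMod n → ℂ) =
      Polynomial.nthRootsFinset n (1 : ℂ) := by
    refine Finset.eq_of_subset_of_card_le ?_ ?_
    · intro z hz
      obtain ⟨h, -, rfl⟩ := Finset.mem_image.mp hz
      rw [Polynomial.mem_nthRootsFinset (NeZero.pos n), ← AddChar.map_nsmul_eq_pow]
      simp
    · rw [(Complex.isPrimitiveRoot_exp n (NeZero.ne n)).card_nthRootsFinset,
        Finset.card_image_of_injective _ ZMod.injective_stdAddChar, Finset.card_univ, ZMod.card]
  rw [← himg, Finset.prod_image fun a _ b _ h => ZMod.injective_stdAddChar h]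

theorem prod_sub_stdAddChar_mul [NeZero n] (x y : ℂ) :
    ∏ h : ZMod n, (x - ZMod.stdAddChar h * y) = x ^ n - y ^ n := by
  rw [IsPrimitiveRoot.pow_sub_pow_eq_prod_sub_mul x y (NeZero.pos n)
    (Complex.isPrimitiveRoot_exp n (NeZero.ne n)), ← prod_stdAddChar fun z => x - z * y]

theorem prod_one_sub_stdAddChar [NeZero n] :
    ∏ h ∈ Finset.univ.erase (0 : ZMod n), (1 - ZMod.stdAddChar h) = (n : ℂ) := by
  have hn : n - 1 + 1 = n := Nat.sub_add_cancel (NeZero.pos n)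
  have h1 := (Complex.isPrimitiveRoot_exp n (NeZero.ne n))
  rw [← hn] at h1
  have h2 := h1.prod_one_sub_pow_eq_order
  have h3 : ((n - 1 : ℕ) : ℂ) + 1 = n := by exact_mod_cast hn
  rw [prod_erase_zero_zmod, prod_Icc_one_eq_prod_range, ← h3, ← h2]
  refine Finset.prod_congr rfl fun l _ => ?_
  have h4 := ZMod.stdAddChar_coe (N := n) ((l + 1 : ℕ) : ℤ)
  rw [Int.cast_natCast] at h4
  rw [h4, hn, ← Complex.exp_nat_mul]
  congr 2
  push_cast
  ring

theorem two_sub_stdAddChar [NeZero n] (j : ℕ) :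
    2 - ZMod.stdAddChar (j : ZMod n) - ZMod.stdAddChar (-(j : ZMod n)) =
      ((4 * Real.sin (j * Real.pi / n) ^ 2 : ℝ) : ℂ) := by
  have h1 := ZMod.stdAddChar_coe (N := n) (j : ℤ)
  have h2 := ZMod.stdAddChar_coe (N := n) (-(j : ℤ))
  rw [Int.cast_natCast] at h1
  rw [Int.cast_neg, Int.cast_natCast] at h2
  rw [h1, h2]
  have h3 : (4 * Real.sin (j * Real.pi / n) ^ 2 : ℝ) =
      2 - 2 * Real.cos (2 * (j * Real.pi / n)) := by
    rw [Real.cos_two_mul, Real.sin_sq]; ring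
  rw [h3]
  push_cast
  rw [Complex.cos]
  have h4 : 2 * (Real.pi : ℂ) * Complex.I * j / n = 2 * (j * Real.pi / n) * Complex.I := by ring
  have h5 : 2 * (Real.pi : ℂ) * Complex.I * -j / n = -(2 * (j * Real.pi / n)) * Complex.I := by
    ring
  rw [h4, h5]
  ring

theorem prod_four_mul_sin_sq [NeZero n] :
    ∏ j ∈ Finset.Icc 1 (n - 1), (4 * Real.sin (j * Real.pi / n) ^ 2) = (n : ℝ) ^ 2 := by
  have h1 : ∏ h ∈ Finset.univ.erase (0 : ZMod n), (1 - ZMod.stdAddChar (-h)) = (n : ℂ) := by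
    rw [← prod_one_sub_stdAddChar]
    refine Finset.prod_nbij' (fun h => -h) (fun h => -h) ?_ ?_ ?_ ?_ ?_ <;> simp
  have h2 : ∏ h ∈ Finset.univ.erase (0 : ZMod n),
      (2 - ZMod.stdAddChar h - ZMod.stdAddChar (-h)) = (n : ℂ) ^ 2 := by
    rw [sq]
    nth_rewrite 1 [← prod_one_sub_stdAddChar (n := n)]
    rw [← h1, ← Finset.prod_mul_distrib]
    refine Finset.prod_congr rfl fun h _ => ?_
    -- For `z * w = 1`, `2 - z - w = (1 - z) * (1 - w)`.
    linear_combination -stdAddChar_mul_neg h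
  rw [prod_erase_zero_zmod, Finset.prod_congr rfl fun j _ => two_sub_stdAddChar j] at h2
  exact_mod_cast h2

open Polynomial in
theorem sineSeq_eq_eval_U (c : ℝ) (k : ℕ) :
    sineSeq (2 * c) (k + 1) = (Chebyshev.U ℝ k).eval c := by
  induction k using Nat.twoStepInduction with
  | zero => simp [sineSeq]
  | one => simp [sineSeq]
  | more k h1 h2 =>
    rw [sineSeq_add_two, h1, h2]
    push_cast
    rw [Chebyshev.U_add_two]
    simp

-- The roots of `Chebyshev.U ℝ k` are cos(lπ/(k+1)). Evaluated at `1 + y / 2`, each linear factor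
-- absorbs one 2 of the leading coefficient `2 ^ k` and becomes `y` plus four times a squared sine,
-- by the double angle formula.
open Polynomial in
theorem sineSeq_eq_prod (y : ℝ) (k : ℕ) :
    sineSeq (y + 2) (k + 1) =
      ∏ l ∈ Finset.Icc 1 k, (y + 4 * Real.sin (l * Real.pi / (2 * (k + 1))) ^ 2) := by
  have hroots := Chebyshev.roots_U_real k
  have hcard : Multiset.card (Chebyshev.U ℝ k).roots = (Chebyshev.U ℝ k).natDegree := by
    rw [hroots, Finset.card_val, Finset.card_image_of_injOn, Finset.card_range,
      Chebyshev.natDegree_U_natCast]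
    exact (Finset.range k).nodup_map_iff_injOn.mp (Chebyshev.roots_U_real_nodup k)
  have h1 := congrArg (eval (1 + y / 2)) (C_leadingCoeff_mul_prod_multiset_X_sub_C hcard)
  rw [show y + 2 = 2 * (1 + y / 2) by ring, sineSeq_eq_eval_U, ← h1, hroots,
    Chebyshev.leadingCoeff_U_natCast]
  change eval _ (C _ * ∏ x ∈ Finset.image _ _, (X - C x)) = _
  rw [Finset.prod_image
    ((Finset.range k).nodup_map_iff_injOn.mp (Chebyshev.roots_U_real_nodup k)), eval_mul, eval_C,
    eval_prod]
  have h2 : (2 : ℝ) ^ k = ∏ _l ∈ Finset.range k, (2 : ℝ) := by simp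
  rw [h2, ← Finset.prod_mul_distrib, prod_Icc_one_eq_prod_range]
  refine Finset.prod_congr rfl fun l _ => ?_
  have h3 : ((l : ℝ) + 1) * Real.pi / (k + 1) =
      2 * (((l + 1 : ℕ) : ℝ) * Real.pi / (2 * (k + 1))) := by
    push_cast; field_simp
  rw [eval_sub, eval_X, eval_C, h3, Real.cos_two_mul, Real.cos_sq']
  ring

end Evaluation

/-! ### Determinant formulas, integrality and Lucas numbers -/

section Main

variable {m n : ℕ}

theorem determinant_thk_mul (hm : 3 ≤ m) [NeZero n] :
    (determinant (thk m n) : ℝ) * n = ‖∏ h ∈ Finset.univ.erase (0 : ZMod n),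
      (twistedColoring m (ZMod.stdAddChar h) (ZMod.stdAddChar (-h))).det‖ := by
  have h1 := determinant_thk_mul_sq (n := n) hm
  have h2 := det_block_add_one_of_sum_eq_pathLaplacian (n := n) (show 0 < m - 1 by omega)
    (coloringBlock m n) (sum_coloringBlock hm)
  rw [Finset.prod_congr rfl fun h _ => congrArg Matrix.det
    (sum_stdAddChar_mul_coloringBlock hm h)] at h2
  have h3 := congrArg norm h2
  rw [Complex.norm_intCast, ← Int.cast_abs, Int.abs_eq_natAbs, Int.cast_natCast, ← h1, norm_mul,
    norm_mul, norm_pow, Complex.norm_natCast, Complex.norm_natCast] at h3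
  have h4 : (0 : ℝ) < n := Nat.cast_pos.mpr (NeZero.pos n)
  have h5 : (0 : ℝ) < (m - 1 : ℕ) := Nat.cast_pos.mpr (by omega)
  push_cast at h3
  refine mul_left_cancel₀ (mul_pos h4 (pow_pos h5 2)).ne' (Eq.trans ?_ h3)
  ring

/-- The product of the nonzero Laplace eigenvalues of a cycle and the sums of the nonzero Laplace
eigenvalues of a cycle and of a path. -/
theorem prod_mul_sineSeq [NeZero n] (k : ℕ) :
    ∏ h ∈ Finset.univ.erase (0 : ZMod n), ((2 - ZMod.stdAddChar h - ZMod.stdAddChar (-h)) *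
      sineSeq (2 - ZMod.stdAddChar h - ZMod.stdAddChar (-h) + 2) (k + 1)) =
    (((n : ℝ) ^ 2 * ∏ a ∈ Finset.Icc 1 (n - 1), ∏ b ∈ Finset.Icc 1 k,
      (4 * Real.sin (a * Real.pi / n) ^ 2 +
        4 * Real.sin (b * Real.pi / (2 * (k + 1))) ^ 2) : ℝ) : ℂ) := by
  rw [prod_erase_zero_zmod, ← prod_four_mul_sin_sq, ← Finset.prod_mul_distrib, Complex.ofReal_prod]
  refine Finset.prod_congr rfl fun j _ => ?_
  rw [two_sub_stdAddChar, ← sineSeq_eq_prod]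
  generalize 4 * Real.sin (j * Real.pi / n) ^ 2 = x
  have := map_sineSeq Complex.ofRealHom (x + 2) (k + 1)
  rw [Complex.ofRealHom_eq_coe, Complex.ofRealHom_eq_coe, Complex.ofReal_add,
    Complex.ofReal_ofNat] at this
  rw [Complex.ofReal_mul, this]

theorem determinant_thk_even [NeZero n] (k : ℕ) :
    (determinant (thk (2 * (k + 2)) n) : ℝ) =
      n * ∏ a ∈ Finset.Icc 1 (n - 1), ∏ b ∈ Finset.Icc 1 (k + 1),
      (4 * Real.sin (a * Real.pi / n) ^ 2 +
        4 * Real.sin (b * Real.pi / (2 * ((k + 1 : ℕ) + 1))) ^ 2) := by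
  have h1 := determinant_thk_mul (m := 2 * (k + 2)) (n := n) (by omega)
  have h2 : ∀ h : ZMod n, (twistedColoring (2 * (k + 2)) (ZMod.stdAddChar h)
      (ZMod.stdAddChar (-h))).det = (2 - ZMod.stdAddChar h - ZMod.stdAddChar (-h)) *
      sineSeq (2 - ZMod.stdAddChar h - ZMod.stdAddChar (-h) + 2) (k + 1 + 1) := by
    intro h
    rw [det_twistedColoring_even (stdAddChar_mul_neg h)]
    congr 2
    ring
  have h4 : (0 : ℝ) < n := Nat.cast_pos.mpr (NeZero.pos n)
  rw [Finset.prod_congr rfl fun h _ => h2 h, prod_mul_sineSeq, Complex.norm_real,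
    Real.norm_of_nonneg] at h1
  · refine mul_right_cancel₀ h4.ne' (h1.trans ?_)
    ring
  · exact mul_nonneg (by positivity) (Finset.prod_nonneg fun _ _ => Finset.prod_nonneg fun _ _ =>
      by positivity)

theorem numSpanningTrees_grid (n k : ℕ) :
    (numSpanningTrees (cycleGraph (n + 3) □ pathGraph (k + 1)) : ℝ) =
      (n + 3 : ℕ) * ∏ a ∈ Finset.Icc 1 (n + 3 - 1), ∏ b ∈ Finset.Icc 1 k,
      (4 * Real.sin (a * Real.pi / (n + 3 : ℕ)) ^ 2 +
        4 * Real.sin (b * Real.pi / (2 * (k + 1))) ^ 2) := by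
  have h1 := congrArg (Int.cast (R := ℂ)) (numSpanningTrees_grid_mul_sq n (k + 1) k.succ_pos)
  have h2 := det_block_add_one_of_sum_eq_pathLaplacian (n := n + 3) k.succ_pos
    (gridBlock (k + 1) (n + 3)) (sum_gridBlock (k + 1))
  rw [Finset.prod_congr rfl fun h _ => (congrArg Matrix.det
    (sum_stdAddChar_mul_gridBlock (k + 1) h)).trans (det_pathLaplacian _ k),
    prod_mul_sineSeq] at h2
  have h3 := h1.trans h2
  rw [← Complex.ofReal_inj]
  have h4 : ((n + 3 : ℕ) : ℂ) ≠ 0 := Nat.cast_ne_zero.mpr (by omega)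
  have h5 : ((k + 1 : ℕ) : ℂ) ≠ 0 := Nat.cast_ne_zero.mpr (by omega)
  refine mul_left_cancel₀ (pow_ne_zero 2 (mul_ne_zero h4 h5)) (Eq.trans ?_ (h3.trans ?_))
  · push_cast; ring
  · push_cast; ring

/-- The product formula of a Turk's Head link with an even number of strands is an integer
greater than one. -/
theorem exists_nat_eq_prod (hn : 3 ≤ n) (k d : ℕ)
    (hd : (d : ℝ) = n * ∏ a ∈ Finset.Icc 1 (n - 1), ∏ b ∈ Finset.Icc 1 (k + 1),
      (4 * Real.sin (a * Real.pi / n) ^ 2 +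
        4 * Real.sin (b * Real.pi / (2 * ((k + 1 : ℕ) + 1))) ^ 2)) :
    ∃ q : ℕ, 1 < q ∧ (q : ℝ) = ∏ a ∈ Finset.Icc 1 (n - 1), ∏ b ∈ Finset.Icc 1 (k + 1),
      (4 * Real.sin (a * Real.pi / n) ^ 2 +
        4 * Real.sin (b * Real.pi / (2 * ((k + 1 : ℕ) + 1))) ^ 2) ∧ d = n * q := by
  have : NeZero n := ⟨by omega⟩
  have hn0 : (n : ℝ) ≠ 0 := Nat.cast_ne_zero.mpr (by omega)
  set Q : ℝ := ∏ a ∈ Finset.Icc 1 (n - 1), ∏ b ∈ Finset.Icc 1 (k + 1),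
      (4 * Real.sin (a * Real.pi / n) ^ 2 +
        4 * Real.sin (b * Real.pi / (2 * ((k + 1 : ℕ) + 1))) ^ 2) with hQ
  have hint : ∀ r : ℚ, IsIntegral ℤ (4 * Real.sin (r * Real.pi) ^ 2) := by
    intro r
    have h := (Real.isIntegral_two_mul_sin_rat_mul_pi r).pow 2
    rwa [mul_pow, show (2 : ℝ) ^ 2 = 4 by norm_num] at h
  have hQint : IsIntegral ℤ Q := by
    refine IsIntegral.prod _ fun a _ => IsIntegral.prod _ fun b _ => IsIntegral.add ?_ ?_
    · have := hint (a / n)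
      push_cast at this
      rwa [div_mul_eq_mul_div] at this
    · have := hint (b / (2 * ((k + 1 : ℕ) + 1)))
      push_cast at this ⊢
      rwa [div_mul_eq_mul_div] at this
  -- `Q` is an algebraic integer, since 2 sin(rπ) is one for rational `r`, and it equals the
  -- rational number `d / n`; hence it is an integer.
  obtain ⟨z, hz⟩ := hQint.exists_int_iff_exists_rat.mp
    ⟨d / n, by push_cast; rw [hd]; field_simp⟩
  -- Dropping the path term from each factor leaves, for every `b`, the product of `4 sin²(aπ/n)`,
  -- which is `n ^ 2`.
  have hlarge : (n : ℝ) ^ 2 ≤ Q := by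
    have h1 : (1 : ℝ) ≤ (n : ℝ) ^ 2 := one_le_pow₀ (by exact_mod_cast (by omega : 1 ≤ n))
    calc (n : ℝ) ^ 2 ≤ ∏ _b ∈ Finset.Icc 1 (k + 1), (n : ℝ) ^ 2 := by
          rw [Finset.prod_const, Nat.card_Icc]
          exact le_self_pow₀ h1 (by omega)
      _ ≤ Q := by
          rw [hQ, Finset.prod_comm, ← prod_four_mul_sin_sq]
          refine Finset.prod_le_prod (fun _ _ => Finset.prod_nonneg fun _ _ => by positivity)
            fun b _ => Finset.prod_le_prod (fun _ _ => by positivity) fun a _ => ?_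
          exact le_add_of_nonneg_right (by positivity)
  have h9 : (9 : ℝ) ≤ Q := by
    have : (3 : ℝ) ≤ n := by exact_mod_cast hn
    nlinarith
  have hz9 : 9 ≤ z := by
    rw [hz] at h9
    exact_mod_cast h9
  lift z to ℕ using by omega
  rw [Int.cast_natCast] at hz
  refine ⟨z, by omega, hz.symm, ?_⟩
  rw [hz] at hd
  exact_mod_cast hd

theorem lucas_add_two (n : ℕ) : lucas (n + 2) = lucas (n + 1) + lucas n := rfl

open Real in
theorem coe_lucas_eq (n : ℕ) : (lucas n : ℝ) = goldenRatio ^ n + goldenConj ^ n := by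
  induction n using Nat.twoStepInduction with
  | zero => norm_num [lucas]
  | one => simp [lucas]
  | more n h1 h2 =>
    rw [lucas_add_two, Nat.cast_add, h1, h2, pow_add _ n 2, pow_add _ n 2, goldenRatio_sq,
      goldenConj_sq]
    ring

theorem le_lucas (n : ℕ) : n ≤ lucas n := by
  induction n using Nat.twoStepInduction with
  | zero => simp
  | one => simp [lucas]
  | more n h1 h2 =>
    rw [lucas_add_two]
    rcases Nat.eq_zero_or_pos n with rfl | hn
    · simp [lucas]
    · omega

/-- For `a`, `b` the squares of the golden ratio and its conjugate, `a * b = 1` and `a + b = 3` give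
3 - z - z⁻¹ = (a - z)(1 - z⁻¹b). Over all z the product is (aⁿ - 1)(1 - bⁿ) = aⁿ + bⁿ - 2. -/
theorem prod_three_sub_stdAddChar [NeZero n] :
    ∏ h : ZMod n, (3 - ZMod.stdAddChar h - ZMod.stdAddChar (-h)) =
      (lucas (2 * n) : ℂ) - 2 := by
  set a : ℂ := ((Real.goldenRatio ^ 2 : ℝ) : ℂ) with ha
  set b : ℂ := ((Real.goldenConj ^ 2 : ℝ) : ℂ) with hb
  have hab : a * b = 1 := by
    rw [ha, hb, ← Complex.ofReal_mul, ← mul_pow, Real.goldenRatio_mul_goldenConj]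
    norm_num
  have hab' : a + b = 3 := by
    rw [ha, hb, ← Complex.ofReal_add, Real.goldenRatio_sq, Real.goldenConj_sq]
    have : Real.goldenRatio + 1 + (Real.goldenConj + 1) = 3 := by
      linear_combination Real.goldenRatio_add_goldenConj
    rw [this]; norm_num
  have h1 := prod_sub_stdAddChar_mul (n := n) a 1
  have h2 := prod_sub_stdAddChar_mul (n := n) 1 b
  rw [← Equiv.prod_comp (Equiv.neg (ZMod n))] at h2
  have h3 : (lucas (2 * n) : ℂ) = a ^ n + b ^ n := by
    rw [ha, hb, ← Complex.ofReal_pow, ← Complex.ofReal_pow, ← Complex.ofReal_add, ← pow_mul,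
      ← pow_mul, ← coe_lucas_eq]
    simp
  have h4 : a ^ n * b ^ n = 1 := by rw [← mul_pow, hab, one_pow]
  rw [h3, show a ^ n + b ^ n - 2 = (a ^ n - 1 ^ n) * (1 ^ n - b ^ n) by
    rw [one_pow]; linear_combination h4, ← h1, ← h2, ← Finset.prod_mul_distrib]
  refine Finset.prod_congr rfl fun h _ => ?_
  rw [Equiv.neg_apply]
  linear_combination -hab' + ZMod.stdAddChar (-h) * hab - b * stdAddChar_mul_neg h

theorem determinant_thk_three (n : ℕ) :
    determinant (thk 3 (n + 3)) = numSpanningTrees (wheelGraph (n + 3)) := by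
  have h1 := determinant_thk_mul (m := 3) (n := n + 3) le_rfl
  rw [Finset.prod_congr rfl fun h _ => det_twistedColoring_three (stdAddChar_mul_neg h),
    Finset.prod_mul_distrib, prod_one_sub_stdAddChar] at h1
  have h2 := numSpanningTrees_wheelGraph n
  -- The factor of the wheel product at z = 1 is 3 - 1 - 1 = 1, so it may be omitted.
  rw [← Finset.mul_prod_erase _ _ (Finset.mem_univ (0 : ZMod (n + 3))), neg_zero,
    AddChar.map_zero_eq_one, show (3 : ℂ) - 1 - 1 = 1 by norm_num, one_mul] at h2
  rw [← h2, norm_mul, Complex.norm_natCast, Complex.norm_natCast, mul_comm] at h1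
  have h4 : ((n + 3 : ℕ) : ℝ) ≠ 0 := Nat.cast_ne_zero.mpr (by omega)
  exact_mod_cast mul_left_cancel₀ h4 h1

theorem coe_determinant_thk_three (n : ℕ) :
    (determinant (thk 3 (n + 3)) : ℤ) = (lucas (2 * (n + 3)) : ℤ) - 2 := by
  have h1 := numSpanningTrees_wheelGraph n
  rw [prod_three_sub_stdAddChar, ← determinant_thk_three] at h1
  exact_mod_cast h1

theorem lucas_two_mul_sub_two_of_even (hn : Even n) :
    (lucas (2 * n) : ℤ) - 2 = 5 * (Nat.fib n : ℤ) ^ 2 := by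
  have h : (lucas (2 * n) : ℝ) - 2 = 5 * (Nat.fib n : ℝ) ^ 2 := by
    have h1 : Real.goldenRatio ^ n * Real.goldenConj ^ n = 1 := by
      rw [← mul_pow, Real.goldenRatio_mul_goldenConj, hn.neg_one_pow]
    have h2 : (5 : ℝ) * (Nat.fib n : ℝ) ^ 2 =
        (Real.goldenRatio ^ n - Real.goldenConj ^ n) ^ 2 := by
      rw [Real.coe_fib_eq]
      generalize Real.goldenRatio ^ n - Real.goldenConj ^ n = x
      rw [div_pow, Real.sq_sqrt (by norm_num)]
      field_simp
    rw [h2, coe_lucas_eq, pow_mul', pow_mul']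
    linear_combination 2 * h1
  exact_mod_cast h

theorem lucas_two_mul_sub_two_of_odd (hn : Odd n) :
    (lucas (2 * n) : ℤ) - 2 = (lucas n : ℤ) ^ 2 := by
  have h : (lucas (2 * n) : ℝ) - 2 = (lucas n : ℝ) ^ 2 := by
    have h1 : Real.goldenRatio ^ n * Real.goldenConj ^ n = -1 := by
      rw [← mul_pow, Real.goldenRatio_mul_goldenConj, hn.neg_one_pow]
    rw [coe_lucas_eq, coe_lucas_eq, pow_mul', pow_mul']
    linear_combination -2 * h1
  exact_mod_cast h

end Main

end TurksHead

/-! ### The theorem -/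

theorem theorem3 (m n : ℕ) (hm : 3 ≤ m) (hn : 3 ≤ n) (hmn : Nat.Coprime m n)
    (h : m = 3 ∨ Even m) :
    (1 < TurksHead.determinant (TurksHead.thk m n) ∧
      ¬ (TurksHead.determinant (TurksHead.thk m n)).Prime) ∧
    (m = 3 →
      TurksHead.determinant (TurksHead.thk m n) =
        TurksHead.numSpanningTrees (TurksHead.wheelGraph n) ∧
      (TurksHead.determinant (TurksHead.thk m n) : ℤ) = (TurksHead.lucas (2 * n) : ℤ) - 2 ∧
      (Even n → TurksHead.determinant (TurksHead.thk m n) = 5 * Nat.fib n ^ 2) ∧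
      (Odd n → TurksHead.determinant (TurksHead.thk m n) = TurksHead.lucas n ^ 2)) ∧
    (Even m →
      TurksHead.determinant (TurksHead.thk m n) =
        TurksHead.numSpanningTrees (cycleGraph n □ pathGraph (m / 2)) ∧
      ∃ q : ℕ, 1 < q ∧
        (q : ℝ) = ∏ j ∈ Finset.Icc 1 (n - 1), ∏ k ∈ Finset.Icc 1 (m / 2 - 1),
          (4 * Real.sin (j * Real.pi / n) ^ 2 + 4 * Real.sin (k * Real.pi / m) ^ 2) ∧
        TurksHead.determinant (TurksHead.thk m n) = n * q) := by
  obtain ⟨l, rfl⟩ := Nat.exists_eq_add_of_le' hn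
  have hthree : m = 3 →
      TurksHead.determinant (TurksHead.thk m (l + 3)) =
        TurksHead.numSpanningTrees (TurksHead.wheelGraph (l + 3)) ∧
      (TurksHead.determinant (TurksHead.thk m (l + 3)) : ℤ) =
        (TurksHead.lucas (2 * (l + 3)) : ℤ) - 2 ∧
      (Even (l + 3) → TurksHead.determinant (TurksHead.thk m (l + 3)) =
        5 * Nat.fib (l + 3) ^ 2) ∧
      (Odd (l + 3) → TurksHead.determinant (TurksHead.thk m (l + 3)) =
        TurksHead.lucas (l + 3) ^ 2) := by
    rintro rfl
    have h1 := TurksHead.coe_determinant_thk_three l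
    refine ⟨TurksHead.determinant_thk_three l, h1, fun he => ?_, fun ho => ?_⟩
    · rw [TurksHead.lucas_two_mul_sub_two_of_even he] at h1
      exact_mod_cast h1
    · rw [TurksHead.lucas_two_mul_sub_two_of_odd ho] at h1
      exact_mod_cast h1
  have heven : Even m →
      TurksHead.determinant (TurksHead.thk m (l + 3)) =
        TurksHead.numSpanningTrees (cycleGraph (l + 3) □ pathGraph (m / 2)) ∧
      ∃ q : ℕ, 1 < q ∧
        (q : ℝ) = ∏ j ∈ Finset.Icc 1 (l + 3 - 1), ∏ k ∈ Finset.Icc 1 (m / 2 - 1),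
          (4 * Real.sin (j * Real.pi / (l + 3 : ℕ)) ^ 2 +
            4 * Real.sin (k * Real.pi / m) ^ 2) ∧
        TurksHead.determinant (TurksHead.thk m (l + 3)) = (l + 3) * q := by
    intro he
    obtain ⟨k, rfl⟩ : ∃ k, m = 2 * (k + 2) := by
      obtain ⟨k, hk⟩ := he
      exact ⟨k - 2, by omega⟩
    have h1 := TurksHead.determinant_thk_even (n := l + 3) k
    have h2 := TurksHead.numSpanningTrees_grid l (k + 1)
    have h3 : 2 * (k + 2) / 2 = k + 1 + 1 := by omega
    have h4 : ((2 * (k + 2) : ℕ) : ℝ) = 2 * ((k + 1 : ℕ) + 1) := by push_cast; ring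
    rw [h3, Nat.add_sub_cancel, h4]
    exact ⟨by exact_mod_cast h1.trans h2.symm, TurksHead.exists_nat_eq_prod hn k _ h1⟩
  refine ⟨?_, hthree, heven⟩
  rcases h with h | h
  · obtain ⟨-, -, h1, h2⟩ := hthree h
    rcases Nat.even_or_odd (l + 3) with he | ho
    · have hpos : 0 < Nat.fib (l + 3) := Nat.fib_pos.mpr (by omega)
      -- The bound is the value `Nat.fib 3 = 2`; it makes the cofactor of 5 larger than 1.
      have hfib : 2 ≤ Nat.fib (l + 3) := Nat.fib_mono (show 3 ≤ l + 3 by omega)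
      rw [h1 he]
      exact ⟨by nlinarith, Nat.not_prime_mul (by norm_num) (by nlinarith)⟩
    · have hlucas := TurksHead.le_lucas (l + 3)
      rw [h2 ho, sq]
      exact ⟨by nlinarith, Nat.not_prime_mul (by omega) (by omega)⟩
  · obtain ⟨-, q, hq, -, hd⟩ := heven h
    rw [hd]
    exact ⟨by nlinarith, Nat.not_prime_mul (by omega) (by omega)⟩
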